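/- **Setting.** Algorithms are programs of a randomized word RAM: words of $w$ bits, unit-cost word operations, array access, and $\mathtt{RandInt}$. An instance $\mathcal R=(R_1(A,B),R_2(B,C))$ of the matrix query consists of two finite relations whose values fit into words. Its result is $\mathcal Q(\mathcal R)=\{(a,c):\exists b,\ (a,b)\in R_1,\ (b,c)\in R_2\}$. Write $N=|R_1|+|R_2|$ and $\mathrm{OUT}=|\mathcal Q(\mathcal R)|$. The instance is stored so that in $O(1)$ time one can draw a random tuple of a relation, test whether a tuple belongs to it, and obtain the degree and the $j$-th neighbour of a value. For $\gamma>0$, a *$\gamma$-fast sampler* is a pair (preprocessing, sampling procedure) of programs such that, for some constants $C,\kappa$, for all $w\ge\kappa\log_2(N+2)$ and all instances with $\mathrm{OUT}\ge 1$: * the answers to successive sampling requests are independent and uniform on $\mathcal Q(\mathcal R)$; * preprocessing takes expected time at most $C\max\{1,N\cdot\mathrm{OUT}^{1/2-\gamma}\}$; * every sample takes expected time at most $C\max\{1,N/\mathrm{OUT}^{1/2+\gamma}\}$. A program multiplies Boolean $n\times n$ matrices in time $O(n^e)$ if, for some constants $C,\kappa$, for all $n$, all inputs and all $w\ge\kappa\log_2(n+2)$,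 with probability at least $2/3$ it halts within $C(n+1)^e$ steps with the correct Boolean product. A *reduction* $T$ is a program that may call the two procedures of a sampler as subroutines, keeping some memory private from them; $T[\mathcal A]$ is the program obtained by inserting the code of the sampler $\mathcal A$. It has *quasilinear overhead* if, for some constants $\kappa,C,d$, for all $n$ and all $w\ge\kappa\log_2(n+2)$, on every pair of $n\times n$ matrices, counting each call as one step, it always makes at most $C(n+1)^2\log^d(n+2)$ steps (with $\log$ the base-2 logarithm, rounded down), whatever the subroutines do to the non-private memory. As "combinatorial algorithm" has no formal definition, the theorem is stated for every class of algorithms that may play this role, provided that the multiplication algorithm obtained from a combinatorial sampler by one fixed reduction of quasilinear overhead is combinatorial. **Theorem.** There is a reduction $T$ with quasilinear overhead such that the following holds for every class $\mathcal S$ of samplers ("combinatorial samplers") and every class $\mathcal M$ of programs ("combinatorial matrix multiplication algorithms") with $T[\mathcal A]\in\mathcal M$ for all $\mathcal A\in\mathcal S$. Assume the combinatorial hardness of Boolean matrix multiplication: for no $\varepsilon>0$ does a program in $\mathcal M$ multiply Boolean $n\times n$ matrices in time $O(n^{3-\varepsilon})$. Then for no constant $\gamma>0$ does $\mathcal S$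 contain a $\gamma$-fast sampler. That is, no combinatorial algorithm preprocesses every instance in $O(N\cdot\mathrm{OUT}^{1/2-\gamma})$ time and generates independent uniform samples from $\mathcal Q(\mathcal R)$ in $O(N/\mathrm{OUT}^{1/2+\gamma})$ expected time each (both bounds read as at least a constant). -/

import Mathlib

open scoped ENNReal

namespace MatrixSampling

/-! ## Randomized word RAM -/

/-- Unit-cost operations on two words. -/
inductive BinOp
  | add | sub | mul | div | mod | and | or | xor | shl | shr | eq | lt

/-- Programs of a randomized word RAM. Registers and arrays are named by natural numbers; an array
cell is addressed by two words. `O` is the type of names of external subroutines. -/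
inductive Cmd (O : Type) : Type
  /-- do nothing -/
  | skip : Cmd O
  /-- `const x n`: `x := n` -/
  | const (x n : ℕ) : Cmd O
  /-- `op f x y z`: `x := f y z` -/
  | op (f : BinOp) (x y z : ℕ) : Cmd O
  /-- `rand x y z`: `x := RandInt(y, z)` -/
  | rand (x y z : ℕ) : Cmd O
  /-- `load x a i j`: `x := a[i][j]` -/
  | load (x a i j : ℕ) : Cmd O
  /-- `store a i j x`: `a[i][j] := x` -/
  | store (a i j x : ℕ) : Cmd O
  /-- sequential composition -/
  | seq (c d : Cmd O) : Cmd O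
  /-- `ite x c d`: if `x ≠ 0` then `c` else `d` -/
  | ite (x : ℕ) (c d : Cmd O) : Cmd O
  /-- `loop x c`: while `x ≠ 0` do `c` -/
  | loop (x : ℕ) (c : Cmd O) : Cmd O
  /-- call of an external subroutine -/
  | call (o : O) : Cmd O

/-- A word RAM program (no external subroutines). -/
abbrev Prog := Cmd Empty

/-- Memory of a machine with words of `w` bits. -/
@[ext] structure State (w : ℕ) where
  /-- contents of the registers -/
  reg : ℕ → BitVec w
  /-- contents of the arrays -/
  arr : ℕ → BitVec w → BitVec w → BitVec w

namespace State

variable {w : ℕ}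

/-- Write the word `v` into register `x`. -/
def setReg (s : State w) (x : ℕ) (v : BitVec w) : State w :=
  ⟨Function.update s.reg x v, s.arr⟩

/-- Write the word `v` into cell `i, j` of array `a`. -/
def setArr (s : State w) (a : ℕ) (i j v : BitVec w) : State w :=
  ⟨s.reg, Function.update s.arr a
    (Function.update (s.arr a) i (Function.update (s.arr a i) j v))⟩

end State

/-- The value of a unit-cost operation (arithmetic is modulo `2 ^ w`). -/
def BinOp.eval {w : ℕ} : BinOp → BitVec w → BitVec w → BitVec w
  | .add, x, y => x + y
  | .sub, x, y => x - y
  | .mul, x, y => x * y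
  | .div, x, y => x / y
  | .mod, x, y => x % y
  | .and, x, y => x &&& y
  | .or, x, y => x ||| y
  | .xor, x, y => x ^^^ y
  | .shl, x, y => x <<< y.toNat
  | .shr, x, y => x >>> y.toNat
  | .eq, x, y => if x = y then BitVec.ofNat w 1 else BitVec.ofNat w 0
  | .lt, x, y => if x.toNat < y.toNat then BitVec.ofNat w 1 else BitVec.ofNat w 0

/-- A uniformly random word from `{y, …, z}` (equal to `y` if `z ≤ y`). -/
noncomputable def randInt {w : ℕ} (y z : BitVec w) : PMF (BitVec w) :=
  (PMF.uniformOfFintype (Fin (z.toNat - y.toNat + 1))).map fun i => y + BitVec.ofNat w i.val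

/-- A configuration: the stack of commands that remain to be executed, and the memory. The machine
has halted when the stack is empty. -/
abbrev Config (O : Type) (w : ℕ) := List (Cmd O) × State w

/-- The behaviour of external subroutines: a random transformation of the memory for each name. -/
abbrev Oracle (O : Type) (w : ℕ) := O → State w → PMF (State w)

/-- One step of the machine. -/
noncomputable def step {O : Type} {w : ℕ} (F : Oracle O w) : Config O w → PMF (Config O w)
  | ([], s) => PMF.pure ([], s)
  | (.skip :: k, s) => PMF.pure (k, s)
  | (.const x n :: k, s) => PMF.pure (k, s.setReg x (BitVec.ofNat w n))
  | (.op f x y z :: k, s) => PMF.pure (k, s.setReg x (f.eval (s.reg y) (s.reg z)))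
  | (.rand x y z :: k, s) => (randInt (s.reg y) (s.reg z)).map fun v => (k, s.setReg x v)
  | (.load x a i j :: k, s) => PMF.pure (k, s.setReg x (s.arr a (s.reg i) (s.reg j)))
  | (.store a i j x :: k, s) => PMF.pure (k, s.setArr a (s.reg i) (s.reg j) (s.reg x))
  | (.seq c d :: k, s) => PMF.pure (c :: d :: k, s)
  | (.ite x c d :: k, s) => PMF.pure ((if s.reg x = 0 then d else c) :: k, s)
  | (.loop x c :: k, s) => PMF.pure (if s.reg x = 0 then k else c :: .loop x c :: k, s)
  | (.call o :: k, s) => (F o s).map fun t => (k, t)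

/-- The distribution of the configuration after `t` steps. -/
noncomputable def runFor {O : Type} {w : ℕ} (F : Oracle O w) : ℕ → Config O w → PMF (Config O w)
  | 0, c => PMF.pure c
  | t + 1, c => (step F c).bind (runFor F t)

namespace Cmd

/-- Distribution after `t` steps of the program `P`, started from memory `s`. -/
noncomputable def run {w : ℕ} (P : Prog) (t : ℕ) (s : State w) : PMF (Config Empty w) :=
  runFor (fun o => o.elim) t ([P], s)

/-- The probability that `P`, started from memory `s`, halts with memory `s'`. (The probability of
having done so within `t` steps increases with `t`.) -/
noncomputable def haltProb {w : ℕ} (P : Prog) (s s' : State w) : ℝ≥0∞ :=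
  ⨆ t : ℕ, P.run t s ([], s')

/-- The expected number of steps of `P`, started from memory `s`, as the sum over `t` of the
probability of not having halted after `t` steps. -/
noncomputable def expectedTime {w : ℕ} (P : Prog) (s : State w) : ℝ≥0∞ :=
  ∑' t : ℕ, (P.run t s).toOuterMeasure {c | c.1 ≠ []}

/-- Rename all registers and arrays. -/
def rename {O : Type} (f : ℕ → ℕ) : Cmd O → Cmd O
  | skip => skip
  | const x n => const (f x) n
  | op g x y z => op g (f x) (f y) (f z)
  | rand x y z => rand (f x) (f y) (f z)
  | load x a i j => load (f x) (f a) (f i) (f j)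
  | store a i j x => store (f a) (f i) (f j) (f x)
  | seq c d => seq (c.rename f) (d.rename f)
  | ite x c d => ite (f x) (c.rename f) (d.rename f)
  | loop x c => loop (f x) (c.rename f)
  | call o => call o

/-- Replace every call of an external subroutine by code. -/
def inline {O : Type} (h : O → Prog) : Cmd O → Prog
  | skip => skip
  | const x n => const x n
  | op g x y z => op g x y z
  | rand x y z => rand x y z
  | load x a i j => load x a i j
  | store a i j x => store a i j x
  | seq c d => seq (c.inline h) (d.inline h)
  | ite x c d => ite x (c.inline h) (d.inline h)
  | loop x c => loop x (c.inline h)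
  | call o => h o

end Cmd

/-! ## Boolean matrix multiplication -/

/-- The Boolean product of two `n × n` Boolean matrices. -/
def boolMul {n : ℕ} (A B : Fin n → Fin n → Bool) (i k : Fin n) : Bool :=
  decide (∃ j, A i j = true ∧ B j k = true)

/-- The word `1` or `0`. -/
def bit (w : ℕ) (b : Bool) : BitVec w := if b then BitVec.ofNat w 1 else BitVec.ofNat w 0

/-- The entry of a matrix at a pair of words (`0` outside of the matrix). -/
def entry {n : ℕ} (w : ℕ) (A : Fin n → Fin n → Bool) (x y : BitVec w) : BitVec w :=
  if h : x.toNat < n ∧ y.toNat < n then bit w (A ⟨x.toNat, h.1⟩ ⟨y.toNat, h.2⟩)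
  else BitVec.ofNat w 0

/-- Initial memory for the multiplication of `A` and `B`: `n` is in register `0`, the matrices are
in arrays `0` and `2`, everything else is `0`. -/
def bmmInput {n : ℕ} (w : ℕ) (A B : Fin n → Fin n → Bool) : State w where
  reg x := if x = 0 then BitVec.ofNat w n else BitVec.ofNat w 0
  arr a x y :=
    match a with
    | 0 => entry w A x y
    | 2 => entry w B x y
    | _ => BitVec.ofNat w 0

/-- Array `4` holds the Boolean product of `A` and `B`. -/
def HoldsProduct {n w : ℕ} (A B : Fin n → Fin n → Bool) (s : State w) : Prop :=
  ∀ i k : Fin n, s.arr 4 (BitVec.ofNat w i.val) (BitVec.ofNat w k.val) = bit w (boolMul A B i k)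

/-- `P` multiplies Boolean `n × n` matrices in time `O(n ^ e)`: for words of `Ω(log n)` bits (at
least `κ log₂ (n + 2)` bits), with probability at least `2/3` it halts with the product within
`C (n + 1) ^ e` steps. -/
def MultipliesInTime (P : Prog) (e : ℝ) : Prop :=
  ∃ (κ : ℕ) (C : ℝ), ∀ (w n : ℕ) (A B : Fin n → Fin n → Bool), (n + 2) ^ κ ≤ 2 ^ w →
    2 / 3 ≤ (P.run ⌊C * ((n : ℝ) + 1) ^ e⌋₊ (bmmInput w A B)).toOuterMeasure
      {c | c.1 = [] ∧ HoldsProduct A B c.2}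

/-- Boolean matrix multiplication is hard for the class `M` of algorithms: none of them runs in
time `O(n ^ (3 - ε))` for a constant `ε > 0`. -/
def BMMHard (M : Set Prog) : Prop :=
  ∀ P ∈ M, ∀ ε : ℝ, 0 < ε → ¬ MultipliesInTime P (3 - ε)

/-! ## The matrix query -/

/-- An instance of the matrix query `π_{A,C} (R₁(A,B) ⋈ R₂(B,C))` with attribute values that fit
into a word. -/
structure Instance (w : ℕ) where
  /-- tuples `(a, b)` -/
  R₁ : Finset (BitVec w × BitVec w)
  /-- tuples `(b, c)` -/
  R₂ : Finset (BitVec w × BitVec w)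

namespace Instance

variable {w : ℕ}

/-- The query result: the pairs `(a, c)` with `(a, b) ∈ R₁` and `(b, c) ∈ R₂` for some `b`. -/
def result (I : Instance w) : Finset (BitVec w × BitVec w) :=
  ((I.R₁ ×ˢ I.R₂).filter fun p => p.1.2 = p.2.1).image fun p => (p.1.1, p.2.2)

/-- The input size `N`. -/
def size (I : Instance w) : ℕ := I.R₁.card + I.R₂.card

/-- The output size `OUT`. -/
def out (I : Instance w) : ℕ := I.result.card

end Instance

/-- All words, in increasing order. -/
def words (w : ℕ) : List (BitVec w) := (List.range (2 ^ w)).map (BitVec.ofNat w)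

section Relation

variable {w : ℕ} (R : Finset (BitVec w × BitVec w))

/-- The tuples of a relation, in lexicographic order. -/
def tuples : List (BitVec w × BitVec w) :=
  (List.product (words w) (words w)).filter fun p => decide (p ∈ R)

/-- The second components of the tuples with first component `x`, in increasing order. -/
def nbrsFst (x : BitVec w) : List (BitVec w) := (words w).filter fun y => decide ((x, y) ∈ R)

/-- The first components of the tuples with second component `y`, in increasing order. -/
def nbrsSnd (y : BitVec w) : List (BitVec w) := (words w).filter fun x => decide ((x, y) ∈ R)

/-- The `j`-th entry of a list of words (`0` if there is none). -/
def nth (l : List (BitVec w)) (j : BitVec w) : BitVec w := l.getD j.toNat (BitVec.ofNat w 0)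

/-- The word that represents the length of a list if `j = 0`, and `0` otherwise. -/
def len (l : List (BitVec w)) (j : BitVec w) : BitVec w :=
  if j = 0 then BitVec.ofNat w l.length else BitVec.ofNat w 0

/-- The list of tuples as a two-column table. -/
def tupleTable (i j : BitVec w) : BitVec w :=
  if j.toNat = 0 then nth ((tuples R).map Prod.fst) i
  else if j.toNat = 1 then nth ((tuples R).map Prod.snd) i
  else BitVec.ofNat w 0

/-- The characteristic function of a relation. -/
def memTable (x y : BitVec w) : BitVec w := bit w (decide ((x, y) ∈ R))

end Relation

/-- Initial memory of a sampling algorithm on the instance `I`. It answers each of the primitives of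
the property testing model in constant time: the sizes of the relations (registers `0`, `1`), the
tuple with a given index (arrays `0`, `1`; together with `RandInt` this gives a uniformly random
tuple), test of a tuple (arrays `2`, `3`), degree of a value of `A` in `R₁`, of `B` in `R₁`, of `B`
in `R₂`, of `C` in `R₂` (arrays `4` to `7`) and their `j`-th neighbour (arrays `8` to `11`).
Everything else is `0`. -/
def samplerInput {w : ℕ} (I : Instance w) : State w where
  reg x :=
    match x with
    | 0 => BitVec.ofNat w I.R₁.card
    | 1 => BitVec.ofNat w I.R₂.card
    | _ => BitVec.ofNat w 0
  arr a x y :=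
    match a with
    | 0 => tupleTable I.R₁ x y
    | 1 => tupleTable I.R₂ x y
    | 2 => memTable I.R₁ x y
    | 3 => memTable I.R₂ x y
    | 4 => len (nbrsFst I.R₁ x) y
    | 5 => len (nbrsSnd I.R₁ x) y
    | 6 => len (nbrsFst I.R₂ x) y
    | 7 => len (nbrsSnd I.R₂ x) y
    | 8 => nth (nbrsFst I.R₁ x) y
    | 9 => nth (nbrsSnd I.R₁ x) y
    | 10 => nth (nbrsFst I.R₂ x) y
    | 11 => nth (nbrsSnd I.R₂ x) y
    | _ => BitVec.ofNat w 0

/-! ## Sampling algorithms -/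

/-- A sampling algorithm: `pre` builds a data structure in memory, and each execution of `sample` on
the memory left by the previous execution returns a pair `(a, c)` in registers `0` and `1`. -/
structure Sampler where
  /-- preprocessing -/
  pre : Prog
  /-- generation of one sample -/
  sample : Prog

namespace Sampler

variable {w : ℕ} (A : Sampler)

/-- The probability that the memory is `s` after preprocessing on `s₀` and `k` samples. -/
noncomputable def memoryProb (s₀ : State w) : ℕ → State w → ℝ≥0∞
  | 0, s => A.pre.haltProb s₀ s
  | k + 1, s => ∑' s', memoryProb s₀ k s' * A.sample.haltProb s' s

/-- The probability that, from memory `s`, the next samples are those of the list. -/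
noncomputable def answersProb : List (BitVec w × BitVec w) → State w → ℝ≥0∞
  | [], _ => 1
  | p :: l, s => ∑' s', A.sample.haltProb s s' *
      (if (s'.reg 0, s'.reg 1) = p then answersProb l s' else 0)

/-- The samples on the instance `I` are independent and uniformly distributed on the query
result. -/
def IsUniformOn (I : Instance w) : Prop :=
  ∀ l : List (BitVec w × BitVec w), (∀ p ∈ l, p ∈ I.result) →
    ∑' s, A.pre.haltProb (samplerInput I) s * A.answersProb l s = ((I.out : ℝ≥0∞)⁻¹) ^ l.length

/-- The expected time for the `k`-th sample (counted from `0`) on the instance `I`. -/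
noncomputable def sampleTime (I : Instance w) (k : ℕ) : ℝ≥0∞ :=
  ∑' s, A.memoryProb (samplerInput I) k s * A.sample.expectedTime s

/-- `A` samples uniformly from the matrix query, with preprocessing in expected time
`O(max 1 (N * OUT ^ (1/2 - γ)))` and every sample in expected time
`O(max 1 (N / OUT ^ (1/2 + γ)))`, on all instances with `OUT ≥ 1`, for words of `Ω(log N)` bits. -/
def SamplesInTime (γ : ℝ) : Prop :=
  ∃ (κ : ℕ) (C : ℝ), ∀ (w : ℕ) (I : Instance w), (I.size + 2) ^ κ ≤ 2 ^ w → 1 ≤ I.out →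
    A.IsUniformOn I ∧
    A.pre.expectedTime (samplerInput I) ≤
      ENNReal.ofReal (C * max 1 ((I.size : ℝ) * (I.out : ℝ) ^ (1 / 2 - γ))) ∧
    ∀ k : ℕ, A.sampleTime I k ≤
      ENNReal.ofReal (C * max 1 ((I.size : ℝ) / (I.out : ℝ) ^ (1 / 2 + γ)))

end Sampler

/-! ## Use of a sampling algorithm as a subroutine -/

/-- A program that multiplies matrices with the help of a sampling algorithm: `call false` stands
for preprocessing and `call true` for the generation of a sample. The registers and arrays with
even names are private, the odd name `2 * x + 1` is the name `x` of the subroutine. -/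
abbrev Reduction := Cmd Bool

namespace Reduction

/-- The program that results from `T` when the code of the sampling algorithm is inserted. -/
def applyTo (T : Reduction) (A : Sampler) : Prog :=
  Cmd.inline (fun b => Cmd.rename (fun x => 2 * x + 1) (if b then A.sample else A.pre)) T

/-- The oracle does not change the registers and arrays with even names. -/
def RespectsPrivate {w : ℕ} (F : Oracle Bool w) : Prop :=
  ∀ b s, ∀ s' ∈ (F b s).support, ∀ x,
    s'.reg (2 * x) = s.reg (2 * x) ∧ s'.arr (2 * x) = s.arr (2 * x)

/-- Whatever the subroutines do, `T` itself makes at most `C (n + 1)² (log₂ (n + 2)) ^ d` steps,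
where a call counts as one step. -/
def QuasilinearOverhead (T : Reduction) : Prop :=
  ∃ κ C d : ℕ, ∀ (w n : ℕ) (A B : Fin n → Fin n → Bool), (n + 2) ^ κ ≤ 2 ^ w →
    ∀ F : Oracle Bool w, RespectsPrivate F →
      ∀ c ∈ (runFor F (C * (n + 1) ^ 2 * Nat.log 2 (n + 2) ^ d) ([T], bmmInput w A B)).support,
        c.1 = []

end Reduction

end MatrixSampling

namespace MatrixSampling

/-! ## Expected values -/

/-! Two `n × n` Boolean matrices are turned into an instance of the matrix query whose result
consists of the ones of the product together with a known block of about `n²` extra pairs. The extra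
tuples are `(x, n)` and `(n, y)` with `n < x, y < 2n + 2`. The middle value `n` is not a matrix
index, so the padding contributes exactly the pairs of values above `n` and leaves the entries of
the product untouched. Hence `N = O(n²)`, while `OUT` lies between `(n + 1)²` and `(2n + 2)²`
whatever the product is. In particular `OUT ≥ 1`, so the guarantees of the sampler apply, and the
number of samples to draw need not depend on the unknown product.

By the coupon collector estimate, `O(n² log n)` independent uniform samples contain all of the
result except with probability `1/16`; marking every sample in an array then yields the product.
With a `γ`-fast sampler, preprocessing costs `O(n² · n ^ (1 - 2γ))` for small `γ`, and each sample
costs `O(n ^ (1 - 2γ))`. The total is `n ^ (3 - 2γ)` up to a logarithm, and half of the saving pays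
for the logarithm. Markov's inequality turns expected time into a deadline that is missed with
probability at most `1/6`, and `1/6 + 1/16 ≤ 1/3`.

Most of the work is to carry this out on the machine. The functional `cost` measures time (`r = 1`,
`f = 0`) and the expected value of a final payoff (`r = 0`) at once; `cost_rename_prog` evaluates it
on inserted sampler code. The predicate `Reaches` treats the deterministic code for every oracle
simultaneously: `reaches_setup` serves both `quasilinearOverhead_samplingReduction` and the
probabilistic analysis. The latter rests on `success_probability`, `expected_time_le`, `time_bound`
and `halts_with_property`. -/

/-- The expected value of `h` under `p`. -/
noncomputable def expect {α : Type*} (p : PMF α) (h : α → ℝ≥0∞) : ℝ≥0∞ := ∑' x, p x * h x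

section Expect

variable {α β : Type*}

@[simp] theorem expect_pure (a : α) (h : α → ℝ≥0∞) : expect (PMF.pure a) h = h a := by
  classical
  unfold expect
  rw [tsum_eq_single a]
  · simp
  · intro b hb; simp [PMF.pure_apply, hb]

theorem expect_bind (p : PMF α) (q : α → PMF β) (h : β → ℝ≥0∞) :
    expect (p.bind q) h = expect p fun a => expect (q a) h := by
  unfold expect
  simp only [PMF.bind_apply, ← ENNReal.tsum_mul_right, ← ENNReal.tsum_mul_left]
  rw [ENNReal.tsum_comm]
  simp only [mul_assoc]

@[simp] theorem expect_map (p : PMF α) (φ : α → β) (h : β → ℝ≥0∞) :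
    expect (p.map φ) h = expect p fun a => h (φ a) := by
  rw [PMF.map, expect_bind]
  simp

theorem expect_mono (p : PMF α) {g h : α → ℝ≥0∞} (H : ∀ a, g a ≤ h a) :
    expect p g ≤ expect p h :=
  ENNReal.tsum_le_tsum fun a => by gcongr; exact H a

theorem expect_mono_support (p : PMF α) {g h : α → ℝ≥0∞} (H : ∀ a ∈ p.support, g a ≤ h a) :
    expect p g ≤ expect p h :=
  ENNReal.tsum_le_tsum fun a => by
    by_cases ha : p a = 0
    · simp [ha]
    · gcongr; exact H a ((PMF.mem_support_iff _ _).2 ha)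

@[simp] theorem expect_const (p : PMF α) (m : ℝ≥0∞) : (expect p fun _ => m) = m := by
  unfold expect
  rw [ENNReal.tsum_mul_right, p.tsum_coe, one_mul]

theorem expect_add (p : PMF α) (g h : α → ℝ≥0∞) :
    (expect p fun a => g a + h a) = expect p g + expect p h := by
  unfold expect
  simp only [mul_add, ENNReal.tsum_add]

theorem expect_mul_left (p : PMF α) (m : ℝ≥0∞) (h : α → ℝ≥0∞) :
    (expect p fun a => m * h a) = m * expect p h := by
  unfold expect
  simp only [← ENNReal.tsum_mul_left]
  exact tsum_congr fun a => by ring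

theorem expect_sum {ι : Type*} (p : PMF α) (s : Finset ι) (h : ι → α → ℝ≥0∞) :
    (expect p fun a => ∑ i ∈ s, h i a) = ∑ i ∈ s, expect p (h i) := by
  classical
  induction s using Finset.induction_on with
  | empty => simp
  | insert i s hi ih => simp only [Finset.sum_insert hi, expect_add, ih]

theorem ennreal_tsum_iSup_of_monotone {f : ℕ → α → ℝ≥0∞} (hf : Monotone f) :
    ∑' a, ⨆ t, f t a = ⨆ t, ∑' a, f t a := by
  simp only [ENNReal.tsum_eq_iSup_sum]
  rw [iSup_comm]
  refine iSup_congr fun s => ?_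
  exact ENNReal.finsetSum_iSup_of_monotone fun a _ _ h => hf h a

theorem expect_iSup_of_monotone (p : PMF α) {f : ℕ → α → ℝ≥0∞} (hf : Monotone f) :
    (expect p fun a => ⨆ t, f t a) = ⨆ t, expect p (f t) := by
  unfold expect
  simp only [ENNReal.mul_iSup]
  exact ennreal_tsum_iSup_of_monotone (f := fun t a => p a * f t a)
    fun i j h a => by dsimp only; gcongr; exact hf h a

theorem toOuterMeasure_eq_expect (p : PMF α) (S : Set α) :
    p.toOuterMeasure S = expect p (S.indicator fun _ => 1) := by
  classical
  rw [PMF.toOuterMeasure_apply, expect]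
  refine tsum_congr fun a => ?_
  by_cases h : a ∈ S <;> simp [h]

end Expect

/-! ## Expected cost of a computation -/

/-- The expected value, after at most `t` steps, of `r` times the number of steps made, plus the
value of `f` at the final memory if the machine has halted. -/
noncomputable def costWithin {O : Type} {w : ℕ} (F : Oracle O w) (r : ℝ≥0∞) (f : State w → ℝ≥0∞) :
    ℕ → Config O w → ℝ≥0∞
  | 0, c => if c.1 = [] then f c.2 else 0
  | t + 1, c => if c.1 = [] then f c.2 else r + expect (step F c) (costWithin F r f t)

/-- The expected value of `r` times the number of steps plus the value of `f` at the final
memory. -/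
noncomputable def cost {O : Type} {w : ℕ} (F : Oracle O w) (r : ℝ≥0∞) (f : State w → ℝ≥0∞)
    (c : Config O w) : ℝ≥0∞ := ⨆ t, costWithin F r f t c

section Cost

variable {O : Type} {w : ℕ} (F : Oracle O w) (r : ℝ≥0∞) (f : State w → ℝ≥0∞)

theorem costWithin_le_succ (t : ℕ) (c : Config O w) :
    costWithin F r f t c ≤ costWithin F r f (t + 1) c := by
  induction t generalizing c with
  | zero => rw [costWithin, costWithin]; split_ifs <;> simp
  | succ t ih =>
    conv_lhs => rw [costWithin]
    conv_rhs => rw [costWithin]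
    split_ifs
    · rfl
    · gcongr; exact expect_mono _ ih

theorem costWithin_monotone : Monotone (costWithin F r f) :=
  monotone_nat_of_le_succ fun t c => costWithin_le_succ F r f t c

theorem costWithin_nil (t : ℕ) (s : State w) : costWithin F r f t ([], s) = f s := by
  cases t <;> simp [costWithin]

@[simp] theorem cost_nil (s : State w) : cost F r f ([], s) = f s := by
  simp [cost, costWithin_nil]

/-- Monotone convergence exchanges the supremum over truncations with the expectation over one step;
dropping the first truncation does not change the supremum. -/
theorem cost_cons (x : Cmd O) (k : List (Cmd O)) (s : State w) :
    cost F r f (x :: k, s) = r + expect (step F (x :: k, s)) (cost F r f) := by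
  have h : (expect (step F (x :: k, s)) (cost F r f)) =
      ⨆ t, expect (step F (x :: k, s)) (costWithin F r f t) :=
    expect_iSup_of_monotone _ (costWithin_monotone F r f)
  rw [h, ENNReal.add_iSup]
  unfold cost
  rw [← Monotone.iSup_nat_add (f := fun t => costWithin F r f t (x :: k, s))
    (fun i j hij => costWithin_monotone F r f hij _) 1]
  refine iSup_congr fun t => ?_
  simp [costWithin]

theorem runFor_nil (t : ℕ) (s : State w) : runFor F t ([], s) = PMF.pure ([], s) := by
  induction t with
  | zero => rfl
  | succ t ih => simp [runFor, step, ih]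

/-- The value of `f` at the memory of a halted machine. -/
noncomputable def haltedValue (f : State w → ℝ≥0∞) (c : Config O w) : ℝ≥0∞ :=
  open scoped Classical in if c.1 = [] then f c.2 else 0

/-- Indicator of the configurations in which the machine has not halted. -/
noncomputable def running (c : Config O w) : ℝ≥0∞ :=
  open scoped Classical in if c.1 = [] then 0 else 1

/-- The number of steps made within time `t` is the sum over `u < t` of the indicator that the
machine is still running at time `u`. This separates the time part of the cost from the payoff part.
-/
theorem costWithin_eq (t : ℕ) (c : Config O w) :
    costWithin F r f t c = r * ∑ u ∈ Finset.range t, expect (runFor F u c) running +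
      expect (runFor F t c) (haltedValue f) := by
  induction t generalizing c with
  | zero => simp [costWithin, runFor, haltedValue]
  | succ t ih =>
    obtain ⟨_ | ⟨x, k⟩, s⟩ := c
    · simp [costWithin_nil, runFor_nil, running, haltedValue]
    · have ih' : costWithin F r f t = fun c =>
          r * ∑ u ∈ Finset.range t, expect (runFor F u c) running +
            expect (runFor F t c) (haltedValue f) := funext ih
      rw [costWithin, ih', expect_add, expect_mul_left, expect_sum, Finset.sum_range_succ']
      simp only [runFor, expect_bind, reduceCtorEq, if_false, expect_pure]
      simp [running, mul_add, add_comm, add_left_comm]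

theorem cost_eq (c : Config O w) :
    cost F r f c = r * ∑' u, expect (runFor F u c) running + cost F 0 f c := by
  unfold cost
  rw [ENNReal.tsum_eq_iSup_nat, ENNReal.mul_iSup, ENNReal.iSup_add_iSup_of_monotone]
  · refine iSup_congr fun t => ?_
    simp [costWithin_eq]
  · intro i j hij
    dsimp only
    gcongr
  · intro i j hij
    exact costWithin_monotone F 0 f hij c

/-- The lower part of the stack is a continuation, so its cost acts as the payoff of the upper part.
Each inequality is an induction on the truncation of one side against the untruncated other side. -/
theorem cost_append (k l : List (Cmd O)) (s : State w) :
    cost F r f (k ++ l, s) = cost F r (fun s' => cost F r f (l, s')) (k, s) := by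
  -- A step inspects only the top command, so it commutes with extending the stack at the bottom.
  have hstep : ∀ (x : Cmd O) (k l : List (Cmd O)) (s : State w),
      step F (x :: k ++ l, s) = (step F (x :: k, s)).map fun c => (c.1 ++ l, c.2) := by
    intro x k l s
    cases x <;> simp [step, PMF.pure_map, PMF.map_comp, Function.comp_def]
    all_goals split_ifs <;> rfl
  apply le_antisymm
  · refine iSup_le fun t => ?_
    induction t generalizing k s with
    | zero =>
      cases k with
      | nil => rw [cost_nil]; exact le_iSup (fun t => costWithin F r f t (l, s)) 0
      | cons x k => simp [costWithin]
    | succ t ih =>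
      cases k with
      | nil => rw [cost_nil]; exact le_iSup (fun t => costWithin F r f t (l, s)) (t + 1)
      | cons x k =>
        rw [cost_cons, costWithin, hstep]
        simp only [List.cons_append, reduceCtorEq, if_false, expect_map]
        gcongr
        exact expect_mono _ fun c => ih c.1 c.2
  · refine iSup_le fun t => ?_
    induction t generalizing k s with
    | zero =>
      cases k with
      | nil => simp [costWithin]
      | cons x k => simp [costWithin]
    | succ t ih =>
      cases k with
      | nil => simp [costWithin]
      | cons x k =>
        rw [List.cons_append, cost_cons, costWithin, ← List.cons_append, hstep]
        simp only [reduceCtorEq, if_false, expect_map]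
        gcongr
        exact expect_mono _ fun c => ih c.1 c.2

theorem cost_cons_eq (x : Cmd O) (k : List (Cmd O)) (s : State w) :
    cost F r f (x :: k, s) = cost F r (fun s' => cost F r f (k, s')) ([x], s) :=
  cost_append F r f [x] k s

theorem cost_zero_const_le (m : ℝ≥0∞) (c : Config O w) : cost F 0 (fun _ => m) c ≤ m := by
  refine iSup_le fun t => ?_
  rw [costWithin_eq, zero_mul, zero_add]
  calc _ ≤ expect (runFor F t c) fun _ => m :=
        expect_mono _ fun c => by unfold haltedValue; split_ifs <;> simp
    _ = m := expect_const _ _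

theorem cost_zero_add (f g : State w → ℝ≥0∞) (c : Config O w) :
    cost F 0 (fun s => f s + g s) c = cost F 0 f c + cost F 0 g c := by
  unfold cost
  rw [ENNReal.iSup_add_iSup_of_monotone
    (fun i j h => costWithin_monotone F 0 f h c) (fun i j h => costWithin_monotone F 0 g h c)]
  refine iSup_congr fun t => ?_
  simp only [costWithin_eq, zero_mul, zero_add, ← expect_add]
  congr 1
  ext c
  unfold haltedValue
  split_ifs <;> simp

end Cost

/-! ## Halting probabilities and expected time of programs -/

section Programs

variable {w : ℕ}

/-- The interpretation of the empty set of subroutine names. -/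
noncomputable abbrev noOracle (w : ℕ) : Oracle Empty w := fun o => o.elim

theorem haltProb_eq (P : Prog) (s s' : State w) :
    P.haltProb s s' = ⨆ t, runFor (noOracle w) t ([P], s) ([], s') := rfl

/-- The point mass at a halted configuration is a truncated cost whose payoff is the indicator of
the final memory, and truncated costs increase. -/
theorem runFor_halted_monotone (c : Config Empty w) (s' : State w) :
    Monotone fun t => runFor (noOracle w) t c ([], s') := by
  classical
  have key : ∀ t, runFor (noOracle w) t c ([], s') =
      costWithin (noOracle w) 0 (fun s => if s = s' then 1 else 0) t c := by
    intro t
    rw [costWithin_eq, zero_mul, zero_add, expect, tsum_eq_single ([], s')]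
    · simp [haltedValue]
    · rintro ⟨k, s⟩ h
      unfold haltedValue
      by_cases h1 : k = []
      · have h2 : s ≠ s' := fun h2 => h (by rw [h1, h2])
        simp [h2]
      · simp [h1]
  intro i j hij
  simp only [key]
  exact costWithin_monotone _ _ _ hij c

theorem cost_zero_eq_tsum (P : Prog) (f : State w → ℝ≥0∞) (s : State w) :
    cost (noOracle w) 0 f ([P], s) = ∑' s', P.haltProb s s' * f s' := by
  simp only [haltProb_eq, ENNReal.iSup_mul]
  rw [ennreal_tsum_iSup_of_monotone
    (f := fun t s' => runFor (noOracle w) t ([P], s) ([], s') * f s')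
    (fun i j h s' => by
      dsimp only
      gcongr
      exact runFor_halted_monotone ([P], s) s' h)]
  refine iSup_congr fun t => ?_
  rw [costWithin_eq, zero_mul, zero_add, expect]
  have hinj : Function.Injective (fun s' : State w => (([], s') : Config Empty w)) :=
    fun a b h => (Prod.ext_iff.1 h).2
  rw [← hinj.tsum_eq]
  · simp [haltedValue]
  · rintro ⟨k, s'⟩ h
    by_cases hk : k = []
    · subst hk; exact ⟨s', rfl⟩
    · simp [haltedValue, hk] at h

theorem expectedTime_eq (P : Prog) (s : State w) :
    P.expectedTime s = ∑' u, expect (runFor (noOracle w) u ([P], s)) running := by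
  unfold Cmd.expectedTime Cmd.run
  refine tsum_congr fun t => ?_
  rw [toOuterMeasure_eq_expect]
  congr 1
  ext c
  unfold running
  by_cases h : c.1 = [] <;> simp [h]

/-- The bridge from `cost` to the two quantities in which the guarantees of a sampler are phrased.
-/
theorem cost_prog (r : ℝ≥0∞) (P : Prog) (f : State w → ℝ≥0∞) (s : State w) :
    cost (noOracle w) r f ([P], s) = r * P.expectedTime s + ∑' s', P.haltProb s s' * f s' := by
  rw [cost_eq, cost_zero_eq_tsum, expectedTime_eq]

theorem haltProb_tsum_le_one (P : Prog) (s : State w) : ∑' s', P.haltProb s s' ≤ 1 := by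
  simpa [cost_zero_eq_tsum] using cost_zero_const_le (noOracle w) 1 ([P], s)

/-- Success within `t` steps is at least as likely as success at all, up to the probability, bounded
by Markov's inequality, that the program has not halted after `t` steps. -/
theorem halts_with_property (P : Prog) (s : State w) (G : State w → Prop) (t : ℕ) {p E : ℝ≥0∞}
    (hp : p ≤ cost (noOracle w) 0 ({s' | G s'}.indicator fun _ => 1) ([P], s))
    (hE : cost (noOracle w) 1 (fun _ => 0) ([P], s) ≤ E) (ht : t ≠ 0) :
    p ≤ (P.run t s).toOuterMeasure {c | c.1 = [] ∧ G c.2} + E / t := by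
  classical
  set c : Config Empty w := ([P], s)
  set hg : Set (Config Empty w) := {c | c.1 = [] ∧ G c.2}
  set f : State w → ℝ≥0∞ := {s' | G s'}.indicator fun _ => 1
  set b : State w → ℝ≥0∞ := {s' | ¬ G s'}.indicator fun _ => 1
  have hfb : ∀ s, f s + b s = 1 := by
    intro s
    by_cases h : G s <;> simp [f, b, h]
  have hb : expect (runFor (noOracle w) t c) (haltedValue b) ≤ cost (noOracle w) 0 b c := by
    refine le_trans ?_ (le_iSup _ t)
    rw [costWithin_eq, zero_mul, zero_add]
  have htot : (P.run t s).toOuterMeasure hg + expect (runFor (noOracle w) t c) (haltedValue b) +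
      expect (runFor (noOracle w) t c) running = 1 := by
    rw [toOuterMeasure_eq_expect]
    change expect (runFor (noOracle w) t c) _ + _ + _ = _
    rw [← expect_add, ← expect_add]
    convert expect_const (runFor (noOracle w) t c) 1 using 2
    ext c'
    unfold haltedValue running
    by_cases h : c'.1 = [] <;> by_cases h' : G c'.2 <;> simp [hg, b, h, h']
  -- Running and halted probabilities add up to one, and the halted one is monotone.
  have hanti : ∀ u, u ≤ t → expect (runFor (noOracle w) t c) running ≤
      expect (runFor (noOracle w) u c) running := by
    intro u hu
    have h1 : ∀ v, expect (runFor (noOracle w) v c) running +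
        expect (runFor (noOracle w) v c) (haltedValue fun _ => 1) = 1 := by
      intro v
      rw [← expect_add]
      convert expect_const (runFor (noOracle w) v c) 1 using 2
      ext c'
      unfold haltedValue running
      by_cases h : c'.1 = [] <;> simp [h]
    have h2 : expect (runFor (noOracle w) u c) (haltedValue fun _ => 1) ≤
        expect (runFor (noOracle w) t c) (haltedValue fun _ => 1) := by
      have := costWithin_monotone (noOracle w) 0 (fun _ => 1) hu c
      simpa [costWithin_eq] using this
    have hfin : expect (runFor (noOracle w) u c) (haltedValue fun _ => 1) ≠ ⊤ := by
      refine ne_top_of_le_ne_top ENNReal.one_ne_top ?_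
      exact le_add_self.trans (h1 u).le
    rw [← ENNReal.add_le_add_iff_right hfin, h1 u]
    exact (add_le_add le_rfl h2).trans (h1 t).le
  -- Expected time is at least the sum over `u < t` of the probability of running at time `u`; each
  -- of these `t` terms is at least the last probability.
  have hmarkov : (t : ℝ≥0∞) * expect (runFor (noOracle w) t c) running ≤ E := by
    refine le_trans ?_ hE
    refine le_trans ?_ (le_iSup _ t)
    rw [costWithin_eq, one_mul]
    refine le_trans ?_ le_self_add
    calc _ = ∑ u ∈ Finset.range t, expect (runFor (noOracle w) t c) running := by simp
      _ ≤ _ := Finset.sum_le_sum fun u hu => hanti u (Finset.mem_range.1 hu).le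
  have hnh : expect (runFor (noOracle w) t c) running ≤ E / t := by
    rw [ENNReal.le_div_iff_mul_le (by simp [ht]) (by simp), mul_comm]
    exact hmarkov
  have hsum : cost (noOracle w) 0 f c + cost (noOracle w) 0 b c ≤ 1 := by
    rw [← cost_zero_add]
    simp only [hfb]
    exact cost_zero_const_le _ _ _
  -- The probability of ever halting with a wrong memory is added to both sides and cancelled, which
  -- needs its finiteness. It also covers the wrong halts within `t` steps.
  have hbfin : cost (noOracle w) 0 b c ≠ ⊤ :=
    ne_top_of_le_ne_top ENNReal.one_ne_top (le_trans le_add_self hsum)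
  rw [← ENNReal.add_le_add_iff_right hbfin]
  calc p + cost (noOracle w) 0 b c ≤ 1 := le_trans (by gcongr) hsum
    _ = _ := htot.symm
    _ ≤ (P.run t s).toOuterMeasure hg + cost (noOracle w) 0 b c + E / t := by gcongr
    _ = _ := by ring

end Programs

/-! ## Inserted code -/

section Rename

variable {w : ℕ}

/-- The part of the memory that a subroutine sees. -/
def State.sub (s : State w) : State w := ⟨fun x => s.reg (2 * x + 1), fun a => s.arr (2 * a + 1)⟩

/-- Replace the part of the memory that a subroutine sees. -/
def State.withSub (s u : State w) : State w :=
  ⟨fun x => if x % 2 = 1 then u.reg (x / 2) else s.reg x,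
    fun a => if a % 2 = 1 then u.arr (a / 2) else s.arr a⟩

@[simp] theorem State.sub_withSub (s u : State w) : (s.withSub u).sub = u := by
  ext x
  · simp [State.sub, State.withSub, Nat.add_mod, show (2 * x + 1) / 2 = x by omega]
  · simp [State.sub, State.withSub, Nat.add_mod, show (2 * x + 1) / 2 = x by omega]

@[simp] theorem State.withSub_sub (s : State w) : s.withSub s.sub = s := by
  refine State.ext (funext fun x => ?_) (funext fun x => ?_) <;> dsimp only [sub, withSub] <;>
    split_ifs
  any_goals rfl
  all_goals rw [show 2 * (x / 2) + 1 = x by omega]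

@[simp] theorem State.reg_withSub_odd (s u : State w) (x : ℕ) :
    (s.withSub u).reg (2 * x + 1) = u.reg x := by
  simp [State.withSub, Nat.add_mod, show (2 * x + 1) / 2 = x by omega]

@[simp] theorem State.reg_withSub_even (s u : State w) (x : ℕ) :
    (s.withSub u).reg (2 * x) = s.reg (2 * x) := by
  simp [State.withSub]

@[simp] theorem State.arr_withSub_odd (s u : State w) (x : ℕ) :
    (s.withSub u).arr (2 * x + 1) = u.arr x := by
  simp [State.withSub, Nat.add_mod, show (2 * x + 1) / 2 = x by omega]

@[simp] theorem State.arr_withSub_even (s u : State w) (x : ℕ) :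
    (s.withSub u).arr (2 * x) = s.arr (2 * x) := by
  simp [State.withSub]

theorem State.withSub_setReg (s u : State w) (x : ℕ) (v : BitVec w) :
    (s.withSub u).setReg (2 * x + 1) v = s.withSub (u.setReg x v) := by
  refine State.ext (funext fun y => ?_) rfl
  simp only [withSub, setReg, Function.update_apply]
  split_ifs <;> first | rfl | omega

theorem State.withSub_setArr (s u : State w) (a : ℕ) (i j v : BitVec w) :
    (s.withSub u).setArr (2 * a + 1) i j v = s.withSub (u.setArr a i j v) := by
  refine State.ext rfl (funext fun y => ?_)
  have h : (2 * a + 1) / 2 = a := by omega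
  simp only [withSub, setArr, Function.update_apply, h]
  split_ifs <;> first | rfl | omega

/-- The name that the name `x` of a subroutine has in a reduction. -/
abbrev subName (x : ℕ) : ℕ := 2 * x + 1

/-- Renamed code touches odd names only, so for a fixed private memory `s` the map `u ↦ s.withSub u`
embeds runs of the original code into runs of the renamed code, step by step. -/
theorem step_rename (s u : State w) (k : List Prog) :
    step (noOracle w) (k.map (Cmd.rename subName), s.withSub u) =
      (step (noOracle w) (k, u)).map fun c => (c.1.map (Cmd.rename subName), s.withSub c.2) := by
  cases k with
  | nil => simp [step, PMF.pure_map]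
  | cons x k =>
    cases x with
    | call o => exact o.elim
    | ite x c d =>
      simp only [step, PMF.pure_map, Cmd.rename, subName, State.reg_withSub_odd, List.map_cons]
      split_ifs <;> rfl
    | loop x c =>
      simp only [step, PMF.pure_map, Cmd.rename, subName, State.reg_withSub_odd, List.map_cons]
      split_ifs <;> rfl
    | _ =>
      simp [step, PMF.pure_map, PMF.map_comp, Function.comp_def, Cmd.rename, subName,
        State.withSub_setReg, State.withSub_setArr]

theorem cost_rename (r : ℝ≥0∞) (f : State w → ℝ≥0∞) (s u : State w) (k : List Prog) :
    cost (noOracle w) r f (k.map (Cmd.rename subName), s.withSub u) =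
      cost (noOracle w) r (fun u' => f (s.withSub u')) (k, u) := by
  unfold cost
  refine iSup_congr fun t => ?_
  induction t generalizing k u with
  | zero => simp [costWithin]
  | succ t ih => simp [costWithin, step_rename, ih]

/-- Inserted code behaves as the original program on the visible memory `s.sub` and hands control
back with the private memory intact. -/
theorem cost_rename_prog (r : ℝ≥0∞) (f : State w → ℝ≥0∞) (s : State w) (P : Prog)
    (k : List Prog) :
    cost (noOracle w) r f (P.rename subName :: k, s) =
      r * P.expectedTime s.sub +
        ∑' u, P.haltProb s.sub u * cost (noOracle w) r f (k, s.withSub u) := by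
  rw [cost_cons_eq, ← cost_prog]
  conv_lhs => rw [← s.withSub_sub]
  exact cost_rename r _ s s.sub [P]

end Rename

/-! ## Bounded computations -/

/-- Within `t` steps, the machine passes through a configuration in `Q`, whatever the outcomes of
the random choices are. -/
inductive Reaches {O : Type} {w : ℕ} (F : Oracle O w) (Q : Config O w → Prop) :
    ℕ → Config O w → Prop
  | here (t : ℕ) (c : Config O w) (h : Q c) : Reaches F Q t c
  | next (t : ℕ) (x : Cmd O) (k : List (Cmd O)) (s : State w)
      (h : ∀ c ∈ (step F (x :: k, s)).support, Reaches F Q t c) : Reaches F Q (t + 1) (x :: k, s)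

section Reaches

variable {O : Type} {w : ℕ} {F : Oracle O w} {Q R : Config O w → Prop}

theorem Reaches.mono {t : ℕ} {c : Config O w} (h : Reaches F Q t c) {u : ℕ} (htu : t ≤ u) :
    Reaches F Q u c := by
  induction h generalizing u with
  | here t c h => exact .here _ _ h
  | next t x k s h ih =>
    obtain ⟨v, rfl⟩ : ∃ v, u = v + 1 := ⟨u - 1, by omega⟩
    exact .next _ _ _ _ fun c hc => ih c hc (by omega)

theorem Reaches.trans {t u : ℕ} {c : Config O w} (h : Reaches F Q t c)
    (h' : ∀ c, Q c → Reaches F R u c) : Reaches F R (t + u) c := by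
  induction h with
  | here t c h => exact (h' c h).mono (by omega)
  | next t x k s h ih =>
    rw [show t + 1 + u = t + u + 1 by omega]
    exact .next _ _ _ _ ih

/-- A halted configuration is fixed by `step`, so halting at some time up to `t` implies being
halted at time exactly `t`. -/
theorem Reaches.halted {t : ℕ} {c : Config O w} (h : Reaches F (fun c => c.1 = []) t c) :
    ∀ c' ∈ (runFor F t c).support, c'.1 = [] := by
  induction h with
  | here t c h =>
    obtain ⟨k, s⟩ := c
    obtain rfl : k = [] := h
    simp [runFor_nil]
  | next t x k s h ih =>
    intro c' hc'
    rw [runFor, PMF.mem_support_bind_iff] at hc'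
    obtain ⟨c, hc, hc'⟩ := hc'
    exact ih c hc c' hc'

theorem Reaches.le_cost {t : ℕ} {c : Config O w} (h : Reaches F Q t c) {r m : ℝ≥0∞}
    {f : State w → ℝ≥0∞} (hQ : ∀ c, Q c → m ≤ cost F r f c) : m ≤ cost F r f c := by
  induction h with
  | here t c h => exact hQ c h
  | next t x k s h ih =>
    rw [cost_cons]
    calc m = expect (step F (x :: k, s)) fun _ => m := (expect_const _ _).symm
      _ ≤ expect (step F (x :: k, s)) (cost F r f) := expect_mono_support _ ih
      _ ≤ _ := le_add_self

theorem Reaches.cost_le {t : ℕ} {c : Config O w} (h : Reaches F Q t c) {r m : ℝ≥0∞}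
    {f : State w → ℝ≥0∞} (hQ : ∀ c, Q c → cost F r f c ≤ m) : cost F r f c ≤ r * t + m := by
  induction h with
  | here t c h => exact (hQ c h).trans le_add_self
  | next t x k s h ih =>
    rw [cost_cons]
    calc r + expect (step F (x :: k, s)) (cost F r f)
        ≤ r + expect (step F (x :: k, s)) fun _ => r * t + m := by
          gcongr; exact expect_mono_support _ ih
      _ = _ := by rw [expect_const]; push_cast; ring

theorem Reaches.of_pure {t : ℕ} {x : Cmd O} {k : List (Cmd O)} {s : State w} {c : Config O w}
    (hx : step F (x :: k, s) = PMF.pure c) (h : Reaches F Q t c) :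
    Reaches F Q (t + 1) (x :: k, s) := by
  refine .next _ _ _ _ fun c' hc' => ?_
  rw [hx, PMF.support_pure, Set.mem_singleton_iff] at hc'
  exact hc' ▸ h

theorem Reaches.seq {t : ℕ} {c d : Cmd O} {k : List (Cmd O)} {s : State w}
    (h : Reaches F Q t (c :: d :: k, s)) : Reaches F Q (t + 1) (.seq c d :: k, s) :=
  .of_pure rfl h

end Reaches

/-! ## Straight-line code -/

namespace Cmd

variable {O : Type} {w : ℕ}

/-- Deterministic code without loops. -/
def StraightLine : Cmd O → Prop
  | seq c d => c.StraightLine ∧ d.StraightLine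
  | ite _ c d => c.StraightLine ∧ d.StraightLine
  | rand _ _ _ => False
  | loop _ _ => False
  | call _ => False
  | _ => True

/-- The effect of straight-line code. -/
def exec : Cmd O → State w → State w
  | const x n, s => s.setReg x (BitVec.ofNat w n)
  | op f x y z, s => s.setReg x (f.eval (s.reg y) (s.reg z))
  | load x a i j, s => s.setReg x (s.arr a (s.reg i) (s.reg j))
  | store a i j x, s => s.setArr a (s.reg i) (s.reg j) (s.reg x)
  | seq c d, s => d.exec (c.exec s)
  | ite x c d, s => if s.reg x = 0 then d.exec s else c.exec s
  | _, s => s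

/-- A bound on the number of steps of straight-line code. -/
def steps : Cmd O → ℕ
  | seq c d => c.steps + d.steps + 1
  | ite _ c d => c.steps + d.steps + 1
  | _ => 1

theorem StraightLine.reaches {F : Oracle O w} {c : Cmd O} (hc : c.StraightLine)
    (k : List (Cmd O)) (s : State w) :
    Reaches F (fun c' => c' = (k, c.exec s)) c.steps (c :: k, s) := by
  induction c generalizing k s with
  | seq c d ihc ihd =>
    refine Reaches.seq ((ihc hc.1 (d :: k) s).trans ?_)
    rintro _ rfl
    exact ihd hc.2 k _
  | ite x c d ihc ihd =>
    refine .of_pure rfl ?_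
    simp only [exec]
    split_ifs
    · exact (ihd hc.2 k s).mono (by omega)
    · exact (ihc hc.1 k s).mono (by omega)
  | rand => exact hc.elim
  | loop => exact hc.elim
  | call => exact hc.elim
  | _ => exact .of_pure rfl (.here _ _ rfl)

end Cmd

/-! ### Straight-line blocks and counted loops inside bounded computations -/

section

variable {O : Type} {w : ℕ} {F : Oracle O w} {Q : Config O w → Prop}

theorem Reaches.straightLine {c : Cmd O} (hc : c.StraightLine) {k : List (Cmd O)} {s : State w}
    {t : ℕ} (h : Reaches F Q t (k, c.exec s)) : Reaches F Q (c.steps + t) (c :: k, s) := by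
  refine (hc.reaches k s).trans ?_
  rintro _ rfl
  exact h

/-- A loop that is executed `m` times. -/
theorem Reaches.loop {x : ℕ} {c : Cmd O} {t m : ℕ} {k : List (Cmd O)} (Inv : ℕ → State w → Prop)
    (hbody : ∀ i < m, ∀ s, Inv i s → s.reg x ≠ 0 ∧
      Reaches F (fun c' => ∃ s', c' = (.loop x c :: k, s') ∧ Inv (i + 1) s') t
        (c :: .loop x c :: k, s))
    (hend : ∀ s, Inv m s → s.reg x = 0) {s : State w} (hs : Inv 0 s) :
    Reaches F (fun c' => ∃ s', c' = (k, s') ∧ Inv m s') (m * (t + 1) + 1) (.loop x c :: k, s) := by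
  have key : ∀ j i s, i + j = m → Inv i s →
      Reaches F (fun c' => ∃ s', c' = (k, s') ∧ Inv m s') (j * (t + 1) + 1)
        (.loop x c :: k, s) := by
    intro j
    induction j with
    | zero =>
      intro i s hi hs
      obtain rfl : i = m := by omega
      refine .of_pure (c := (k, s)) ?_ (.here _ _ ⟨s, rfl, hs⟩)
      simp [step, hend s hs]
    | succ j ih =>
      intro i s hi hs
      obtain ⟨h0, h⟩ := hbody i (by omega) s hs
      -- Each round costs one test and `t` steps for the body; the remaining `1` is the test that
      -- leaves the loop.
      rw [show (j + 1) * (t + 1) + 1 = (t + (j * (t + 1) + 1)) + 1 by ring]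
      refine .of_pure (c := (c :: .loop x c :: k, s)) ?_ ?_
      · simp [step, show ¬ s.reg x = 0#w from h0]
      · refine h.trans ?_
        rintro _ ⟨s', rfl, hs'⟩
        exact ih (i + 1) s' (by omega) hs'
  exact key m 0 s (by omega) hs

end

/-! ## Tables of a relation to which tuples are added in lexicographic order -/

/-- Split the sorted list at `y`: before `y` the two filters agree, and after `y` nothing passes
either of them, since elements satisfying `p` precede `y`. Adding a largest element therefore
appends it. -/
theorem filter_or_eq_of_pairwise {α : Type*} {r : α → α → Prop} [DecidableEq α]
    (hr : ∀ a b, r a b → ¬ r b a) {L : List α} (hL : L.Pairwise r) {y : α} (hy : y ∈ L)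
    (p : α → Prop) [DecidablePred p] (hp : ∀ z, p z → r z y) :
    (L.filter fun z => decide (z = y ∨ p z)) = L.filter (fun z => decide (p z)) ++ [y] := by
  obtain ⟨l₁, l₂, rfl⟩ := List.append_of_mem hy
  rw [List.pairwise_append, List.pairwise_cons] at hL
  obtain ⟨-, ⟨h2, -⟩, h3⟩ := hL
  have hirr : ∀ a, ¬ r a a := fun a h => hr a a h h
  have h1' : l₁.filter (fun z => decide (z = y ∨ p z)) = l₁.filter fun z => decide (p z) := by
    refine List.filter_congr fun z hz => ?_
    have : z ≠ y := by rintro rfl; exact hirr z (h3 z hz z (by simp))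
    simp [this]
  have h2' : ∀ z ∈ l₂, z ≠ y ∧ ¬ p z := fun z hz =>
    ⟨by rintro rfl; exact hirr z (h2 z hz), fun h => hr _ _ (h2 z hz) (hp z h)⟩
  have h4 : l₂.filter (fun z => decide (z = y ∨ p z)) = [] := by
    rw [List.filter_eq_nil_iff]
    intro z hz
    simp [h2' z hz]
  have h5 : l₂.filter (fun z => decide (p z)) = [] := by
    rw [List.filter_eq_nil_iff]
    intro z hz
    simp [h2' z hz]
  have hy' : ¬ p y := fun h => hirr y (hp y h)
  rw [List.filter_append, List.filter_append, h1', List.filter_cons_of_pos (by simp),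
    List.filter_cons_of_neg (by simpa using hy'), h4, h5, List.append_nil]

section Words

variable {w : ℕ}

theorem mem_words (x : BitVec w) : x ∈ words w := by
  simp only [words, List.mem_map, List.mem_range]
  exact ⟨x.toNat, x.isLt, by simp⟩

theorem words_pairwise (w : ℕ) : (words w).Pairwise fun x y => x.toNat < y.toNat := by
  rw [words, List.pairwise_map]
  have h := List.pairwise_lt_range (n := 2 ^ w)
  refine h.imp_of_mem fun {a b} ha hb hab => ?_
  rw [List.mem_range] at ha hb
  simpa [BitVec.toNat_ofNat, Nat.mod_eq_of_lt ha, Nat.mod_eq_of_lt hb] using hab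

/-- The lexicographic order on pairs of words. -/
def LexLt (p q : BitVec w × BitVec w) : Prop :=
  p.1.toNat < q.1.toNat ∨ p.1 = q.1 ∧ p.2.toNat < q.2.toNat

theorem LexLt.asymm (p q : BitVec w × BitVec w) (h : LexLt p q) : ¬ LexLt q p := by
  rintro (h' | ⟨h', h''⟩) <;> rcases h with h | ⟨h1, h2⟩
  · omega
  · rw [h1] at h'; omega
  · rw [h'] at h; omega
  · omega

theorem product_words_pairwise (w : ℕ) : ((words w).product (words w)).Pairwise LexLt := by
  rw [List.product, List.pairwise_flatMap]
  constructor
  · intro x _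
    rw [List.pairwise_map]
    exact (words_pairwise w).imp fun h => Or.inr ⟨rfl, h⟩
  · refine (words_pairwise w).imp fun {a b} h => ?_
    simp only [List.mem_map]
    rintro _ ⟨y, _, rfl⟩ _ ⟨z, _, rfl⟩
    exact Or.inl h

variable {R : Finset (BitVec w × BitVec w)} {i j : BitVec w}

/-- The reason for treating pairs in lexicographic order: a new tuple is the largest so far, so no
table entry has to be shifted and a constant number of writes suffices. -/
theorem tuples_insert (h : ∀ q ∈ R, LexLt q (i, j)) :
    tuples (insert (i, j) R) = tuples R ++ [(i, j)] := by
  unfold tuples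
  simp only [Finset.mem_insert]
  exact filter_or_eq_of_pairwise LexLt.asymm (product_words_pairwise w)
    (List.mem_product.2 ⟨mem_words _, mem_words _⟩) (· ∈ R) h

theorem length_tuples (R : Finset (BitVec w × BitVec w)) : (tuples R).length = R.card := by
  have hnd : (tuples R).Nodup :=
    ((product_words_pairwise w).imp (S := (· ≠ ·))
      fun {a b} h => by rintro rfl; exact h.asymm _ _ h).filter _
  rw [← List.toFinset_card_of_nodup hnd]
  congr 1
  ext p
  have hp : p ∈ (words w).product (words w) := List.mem_product.2 ⟨mem_words _, mem_words _⟩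
  simp [tuples, hp]

theorem nbrsFst_insert_of_ne {x : BitVec w} (hx : x ≠ i) :
    nbrsFst (insert (i, j) R) x = nbrsFst R x := by
  simp [nbrsFst, hx]

theorem nbrsFst_insert (h : ∀ q ∈ R, LexLt q (i, j)) :
    nbrsFst (insert (i, j) R) i = nbrsFst R i ++ [j] := by
  unfold nbrsFst
  simp only [Finset.mem_insert, Prod.mk.injEq, true_and]
  refine filter_or_eq_of_pairwise (r := fun x y => x.toNat < y.toNat) (fun a b => by omega)
    (words_pairwise w) (mem_words j) (fun y => (i, y) ∈ R) fun y hy => ?_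
  rcases h _ hy with h | ⟨-, h⟩
  · exact absurd h (lt_irrefl _)
  · exact h

theorem nbrsSnd_insert_of_ne {y : BitVec w} (hy : y ≠ j) :
    nbrsSnd (insert (i, j) R) y = nbrsSnd R y := by
  simp [nbrsSnd, hy]

theorem nbrsSnd_insert (h : ∀ q ∈ R, LexLt q (i, j)) :
    nbrsSnd (insert (i, j) R) j = nbrsSnd R j ++ [i] := by
  unfold nbrsSnd
  simp only [Finset.mem_insert, Prod.mk.injEq, and_true]
  refine filter_or_eq_of_pairwise (r := fun x y => x.toNat < y.toNat) (fun a b => by omega)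
    (words_pairwise w) (mem_words i) (fun x => (x, j) ∈ R) fun x hx => ?_
  rcases h _ hx with h | ⟨-, h⟩
  · exact h
  · exact absurd h (lt_irrefl _)

theorem length_filter_words_le (p : BitVec w → Bool) : ((words w).filter p).length ≤ 2 ^ w := by
  refine (List.length_filter_le _ _).trans ?_
  simp [words]

/-- The list still has at most `2 ^ w` entries after the insertion, so there was room for one more.
Hence the old length fits into a word and is a valid index. -/
theorem length_nbrsFst_lt (h : ∀ q ∈ R, LexLt q (i, j)) : (nbrsFst R i).length < 2 ^ w := by
  have h1 : (nbrsFst (insert (i, j) R) i).length ≤ 2 ^ w := length_filter_words_le _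
  rw [nbrsFst_insert h] at h1
  simpa using h1

theorem length_nbrsSnd_lt (h : ∀ q ∈ R, LexLt q (i, j)) : (nbrsSnd R j).length < 2 ^ w := by
  have h1 : (nbrsSnd (insert (i, j) R) j).length ≤ 2 ^ w := length_filter_words_le _
  rw [nbrsSnd_insert h] at h1
  simpa using h1

theorem nth_concat (l : List (BitVec w)) (v k : BitVec w) (hl : l.length < 2 ^ w) :
    nth (l ++ [v]) k = if k = BitVec.ofNat w l.length then v else nth l k := by
  have hk : k = BitVec.ofNat w l.length ↔ k.toNat = l.length := by
    rw [← BitVec.toNat_inj, BitVec.toNat_ofNat, Nat.mod_eq_of_lt hl]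
  simp only [hk, nth, List.getD_eq_getElem?_getD, List.getElem?_append]
  split_ifs with h1 h2 h2
  · omega
  · rfl
  · simp [h2]
  -- Beyond the new entry both lists give the default value `0`.
  · rw [List.getElem?_eq_none (by simp; omega), List.getElem?_eq_none (by omega)]

/-- Change one cell of an array. -/
def updCell (f : BitVec w → BitVec w → BitVec w) (i j v : BitVec w) : BitVec w → BitVec w → BitVec w :=
  Function.update f i (Function.update (f i) j v)

theorem updCell_apply (f : BitVec w → BitVec w → BitVec w) (i j v x y : BitVec w) :
    updCell f i j v x y = if x = i ∧ y = j then v else f x y := by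
  unfold updCell
  by_cases hx : x = i
  · subst hx
    by_cases hy : y = j <;> simp [hy]
  · simp [hx]

theorem State.arr_setArr (s : State w) (a b : ℕ) (i j v : BitVec w) :
    (s.setArr a i j v).arr b = if b = a then updCell (s.arr a) i j v else s.arr b := by
  simp [State.setArr, updCell, Function.update_apply]

/-- `hw` keeps the column indices `0` and `1` apart as words, and `hR` keeps the row index from
wrapping around. -/
theorem tupleTable_insert (h : ∀ q ∈ R, LexLt q (i, j)) (hw : 1 < 2 ^ w) (hR : R.card < 2 ^ w) :
    tupleTable (insert (i, j) R) =
      updCell (updCell (tupleTable R) (BitVec.ofNat w R.card) (BitVec.ofNat w 0) i)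
        (BitVec.ofNat w R.card) (BitVec.ofNat w 1) j := by
  funext x y
  have h0 : y = BitVec.ofNat w 0 ↔ y.toNat = 0 := by
    rw [← BitVec.toNat_inj]; simp
  have h1 : y = BitVec.ofNat w 1 ↔ y.toNat = 1 := by
    rw [← BitVec.toNat_inj, BitVec.toNat_ofNat, Nat.mod_eq_of_lt hw]
  simp only [updCell_apply, h0, h1, tupleTable, tuples_insert h, List.map_append, List.map_cons,
    List.map_nil]
  rw [nth_concat _ _ _ (by simpa [length_tuples] using hR),
    nth_concat _ _ _ (by simpa [length_tuples] using hR)]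
  simp only [List.length_map, length_tuples]
  by_cases hx : x = BitVec.ofNat w R.card <;> by_cases hy : y.toNat = 0 <;>
    by_cases hy' : y.toNat = 1 <;> simp [hx, hy, hy']

theorem memTable_insert :
    memTable (insert (i, j) R) = updCell (memTable R) i j (BitVec.ofNat w 1) := by
  funext x y
  simp only [updCell_apply, memTable, Finset.mem_insert, Prod.mk.injEq]
  by_cases h : x = i ∧ y = j <;> simp [h, bit]

theorem len_nbrsFst_insert (h : ∀ q ∈ R, LexLt q (i, j)) :
    (fun x y => len (nbrsFst (insert (i, j) R) x) y) =
      updCell (fun x y => len (nbrsFst R x) y) i (BitVec.ofNat w 0)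
        (len (nbrsFst R i) (BitVec.ofNat w 0) + BitVec.ofNat w 1) := by
  funext x y
  rw [updCell_apply]
  by_cases hx : x = i
  · subst hx
    by_cases hy : y = 0#w <;> simp [nbrsFst_insert h, len, hy, BitVec.ofNat_add]
  · simp [hx, nbrsFst_insert_of_ne hx]

theorem len_nbrsSnd_insert (h : ∀ q ∈ R, LexLt q (i, j)) :
    (fun x y => len (nbrsSnd (insert (i, j) R) x) y) =
      updCell (fun x y => len (nbrsSnd R x) y) j (BitVec.ofNat w 0)
        (len (nbrsSnd R j) (BitVec.ofNat w 0) + BitVec.ofNat w 1) := by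
  funext x y
  rw [updCell_apply]
  by_cases hx : x = j
  · subst hx
    by_cases hy : y = 0#w <;> simp [nbrsSnd_insert h, len, hy, BitVec.ofNat_add]
  · simp [hx, nbrsSnd_insert_of_ne hx]

theorem nth_nbrsFst_insert (h : ∀ q ∈ R, LexLt q (i, j)) :
    (fun x y => nth (nbrsFst (insert (i, j) R) x) y) =
      updCell (fun x y => nth (nbrsFst R x) y) i (len (nbrsFst R i) (BitVec.ofNat w 0)) j := by
  funext x y
  rw [updCell_apply]
  by_cases hx : x = i
  · subst hx
    simp [nbrsFst_insert h, len, nth_concat _ _ _ (length_nbrsFst_lt h)]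
  · simp [hx, nbrsFst_insert_of_ne hx]

theorem nth_nbrsSnd_insert (h : ∀ q ∈ R, LexLt q (i, j)) :
    (fun x y => nth (nbrsSnd (insert (i, j) R) x) y) =
      updCell (fun x y => nth (nbrsSnd R x) y) j (len (nbrsSnd R j) (BitVec.ofNat w 0)) i := by
  funext x y
  rw [updCell_apply]
  by_cases hx : x = j
  · subst hx
    simp [nbrsSnd_insert h, len, nth_concat _ _ _ (length_nbrsSnd_lt h)]
  · simp [hx, nbrsSnd_insert_of_ne hx]

end Words

/-! ## The reduction -/

section Code

variable {O : Type}

/-- Sequential composition of a list of commands. -/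
def block : List (Cmd O) → Cmd O
  | [] => .skip
  | c :: l => .seq c (block l)

/-- Append the pair in registers `10`, `12` to the tables of relation `R₁` (`ρ = 0`) or `R₂`
(`ρ = 1`). -/
def appendTuple (ρ : ℕ) : Cmd O := block [
  -- Odd names are sampler names under `x ↦ 2 * x + 1`: the sizes and tuple tables are `1 + 2ρ`, the
  -- characteristic function `5 + 2ρ`, the degrees `9 + 4ρ` and `11 + 4ρ`, the neighbour lists `17 +
  -- 4ρ` and `19 + 4ρ`. Registers `4` and `6` hold the constants `1` and `0`; register `22` is
  -- scratch space for a degree, which is also the index of the new neighbour.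
  .store (1 + 2 * ρ) (1 + 2 * ρ) 6 10,
  .store (1 + 2 * ρ) (1 + 2 * ρ) 4 12,
  .store (5 + 2 * ρ) 10 12 4,
  .load 22 (9 + 4 * ρ) 10 6,
  .store (17 + 4 * ρ) 10 22 12,
  .op .add 22 22 4,
  .store (9 + 4 * ρ) 10 6 22,
  .load 22 (11 + 4 * ρ) 12 6,
  .store (19 + 4 * ρ) 12 22 10,
  .op .add 22 22 4,
  .store (11 + 4 * ρ) 12 6 22,
  .op .add (1 + 2 * ρ) (1 + 2 * ρ) 4]

/-- Register `18` becomes nonzero if array `a` holds a `1` at registers `10`, `12`, or register `x`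
equals `n` and register `y` exceeds `n`. -/
def testTuple (a x y : ℕ) : Cmd O := block [
  .load 18 a 10 12,
  .op .eq 20 x 0,
  .op .lt 22 0 y,
  .op .and 20 20 22,
  .op .or 18 18 20]

/-- Treat the pair with number `q` (register `14`). -/
def fillBody : Cmd O := block [
  .op .div 10 14 2,
  .op .mod 12 14 2,
  testTuple 0 12 10,
  .ite 18 (appendTuple 0) .skip,
  testTuple 2 10 12,
  .ite 18 (appendTuple 1) .skip,
  .op .add 14 14 4,
  .op .sub 16 16 4]

/-- Initialization of the registers. -/
def initCode : Cmd O := block [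
  .const 4 1,
  .const 6 0,
  .const 8 2,
  .op .add 2 0 0,
  .op .add 2 2 8,
  .op .mul 16 2 2,
  .const 14 0]

/-- One step of the computation of the binary length. -/
def sizeBody : Cmd O := block [.op .shr 26 26 4, .op .add 24 24 4]

/-- Preparation of the computation of the binary length of register `2`. -/
def sizeInit : Cmd O := block [.op .add 26 2 6, .const 24 0]

/-- Computation of the number of samples. -/
def countCode : Cmd O := block [
  .op .mul 28 2 2,
  .op .mul 28 28 24,
  .const 20 4,
  .op .mul 28 28 20]

/-- Construction of the instance and of the number of samples. -/
def setup : Cmd O :=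
  .seq initCode (.seq (.loop 16 fillBody) (.seq sizeInit (.seq (.loop 26 sizeBody) countCode)))

/-- Draw the samples and mark them in the product matrix. -/
def samplingLoop (sample : Cmd O) : Cmd O :=
  -- Registers `1` and `3` are the sampler's output registers `0` and `1`; register `4` holds the
  -- word `1`, and array `4` is the product matrix.
  .loop 28 (.seq (.op .sub 28 28 4) (.seq sample (.store 4 1 3 4)))

end Code

/-- Matrix multiplication by sampling from the matrix query. -/
def samplingReduction : Reduction :=
  .seq setup (.seq (.call false) (samplingLoop (.call true)))

theorem applyTo_samplingReduction (A : Sampler) : samplingReduction.applyTo A =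
    .seq setup (.seq (A.pre.rename subName) (samplingLoop (A.sample.rename subName))) := rfl

/-! ## The constructed instance -/

/-- Membership in the first relation: the matrix, and additional tuples `(x, n)`, `x > n`. -/
def LeftTuple {n : ℕ} (A : Fin n → Fin n → Bool) (x y : ℕ) : Prop :=
  (∃ (hx : x < n) (hy : y < n), A ⟨x, hx⟩ ⟨y, hy⟩ = true) ∨ (y = n ∧ n < x)

/-- Membership in the second relation: the matrix, and additional tuples `(n, y)`, `y > n`. -/
def RightTuple {n : ℕ} (B : Fin n → Fin n → Bool) (x y : ℕ) : Prop :=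
  (∃ (hx : x < n) (hy : y < n), B ⟨x, hx⟩ ⟨y, hy⟩ = true) ∨ (x = n ∧ n < y)

open scoped Classical in
/-- The pairs that satisfy `p`, among the first `k` pairs of numbers below `P` in lexicographic
order. -/
noncomputable def initialRel (w P : ℕ) (p : ℕ → ℕ → Prop) (k : ℕ) : Finset (BitVec w × BitVec w) :=
  Finset.univ.filter fun q =>
    q.2.toNat < P ∧ q.1.toNat * P + q.2.toNat < k ∧ p q.1.toNat q.2.toNat

section InitialRel

variable {w P : ℕ} {p : ℕ → ℕ → Prop} {k : ℕ}

theorem mem_initialRel {q : BitVec w × BitVec w} : q ∈ initialRel w P p k ↔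
    q.2.toNat < P ∧ q.1.toNat * P + q.2.toNat < k ∧ p q.1.toNat q.2.toNat := by
  simp [initialRel]

theorem initialRel_zero : initialRel w P p 0 = ∅ := by
  ext q
  simp [mem_initialRel]

/-- The code `x * P + y` is injective for `y < P` and takes values below `k`. -/
theorem card_initialRel_le : (initialRel w P p k).card ≤ k := by
  have h : Set.InjOn (fun q : BitVec w × BitVec w => q.1.toNat * P + q.2.toNat)
      (initialRel w P p k) := by
    rintro ⟨x, y⟩ hq ⟨x', y'⟩ hq' h
    simp only [Finset.mem_coe, mem_initialRel] at hq hq' h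
    have hP : 0 < P := by omega
    have h1 : (x.toNat * P + y.toNat) / P = x.toNat := by
      rw [mul_comm, Nat.mul_add_div hP, Nat.div_eq_of_lt hq.1, add_zero]
    have h2 : (x'.toNat * P + y'.toNat) / P = x'.toNat := by
      rw [mul_comm, Nat.mul_add_div hP, Nat.div_eq_of_lt hq'.1, add_zero]
    have hx : x.toNat = x'.toNat := by rw [← h1, ← h2, h]
    have hy : y.toNat = y'.toNat := by rw [hx] at h; omega
    rw [BitVec.toNat_inj] at hx hy
    rw [hx, hy]
  simpa using Finset.card_le_card_of_injOn (t := Finset.range k) _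
    (fun q hq => by simpa using (mem_initialRel.1 hq).2.1) h

variable (hP : P ≤ 2 ^ w) (hk : k < P * P)
include hP hk

theorem lexLt_of_mem_initialRel {q : BitVec w × BitVec w} (hq : q ∈ initialRel w P p k) :
    LexLt q (BitVec.ofNat w (k / P), BitVec.ofNat w (k % P)) := by
  have hP0 : 0 < P := Nat.pos_of_ne_zero (by rintro rfl; simp at hk)
  have hd : k / P < P := Nat.div_lt_of_lt_mul hk
  have hm : k % P < P := Nat.mod_lt _ hP0
  obtain ⟨h1, h2, -⟩ := mem_initialRel.1 hq
  have hk' := Nat.div_add_mod k P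
  have hle : q.1.toNat ≤ k / P := by
    rw [Nat.le_div_iff_mul_le hP0]; omega
  unfold LexLt
  simp only [BitVec.toNat_ofNat, Nat.mod_eq_of_lt (hd.trans_le hP), Nat.mod_eq_of_lt (hm.trans_le hP)]
  rcases hle.lt_or_eq with h | h
  · exact Or.inl h
  · refine Or.inr ⟨?_, ?_⟩
    · rw [← h]; simp
    · rw [h, mul_comm] at h2; omega

/-- The only pair with `y < P` and code `k` is `(k / P, k % P)`. -/
theorem initialRel_succ [Decidable (p (k / P) (k % P))] : initialRel w P p (k + 1) =
    if p (k / P) (k % P) then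
      insert (BitVec.ofNat w (k / P), BitVec.ofNat w (k % P)) (initialRel w P p k)
    else initialRel w P p k := by
  have hP0 : 0 < P := Nat.pos_of_ne_zero (by rintro rfl; simp at hk)
  have hd : k / P < P := Nat.div_lt_of_lt_mul hk
  have hm : k % P < P := Nat.mod_lt _ hP0
  have hk' := Nat.div_add_mod k P
  have hmd := Nat.mod_eq_of_lt (hd.trans_le hP)
  have hmm := Nat.mod_eq_of_lt (hm.trans_le hP)
  have key : ∀ q : BitVec w × BitVec w, q.2.toNat < P → q.1.toNat * P + q.2.toNat = k →
      q = (BitVec.ofNat w (k / P), BitVec.ofNat w (k % P)) := by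
    intro q h1 h2
    have h3 : k / P = q.1.toNat := by
      rw [← h2, mul_comm, Nat.mul_add_div hP0, Nat.div_eq_of_lt h1, add_zero]
    have h4 : k % P = q.2.toNat := by
      rw [← h2, mul_comm, Nat.mul_add_mod, Nat.mod_eq_of_lt h1]
    rw [h3, h4]
    simp
  ext q
  split_ifs with h
  · rw [Finset.mem_insert, mem_initialRel, mem_initialRel]
    constructor
    · rintro ⟨h1, h2, h3⟩
      by_cases h4 : q.1.toNat * P + q.2.toNat = k
      · exact Or.inl (key q h1 h4)
      · exact Or.inr ⟨h1, by omega, h3⟩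
    · rintro (rfl | ⟨h1, h2, h3⟩)
      · simp only [BitVec.toNat_ofNat, hmd, hmm]
        refine ⟨hm, ?_, h⟩
        rw [mul_comm]; omega
      · exact ⟨h1, by omega, h3⟩
  · rw [mem_initialRel, mem_initialRel]
    constructor
    · rintro ⟨h1, h2, h3⟩
      by_cases h4 : q.1.toNat * P + q.2.toNat = k
      · rw [key q h1 h4] at h3
        simp only [BitVec.toNat_ofNat, hmd, hmm] at h3
        exact absurd h3 h
      · exact ⟨h1, by omega, h3⟩
    · rintro ⟨h1, h2, h3⟩
      exact ⟨h1, by omega, h3⟩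

end InitialRel

/-- The instance after treatment of `k` pairs. -/
noncomputable def initialInstance {n : ℕ} (w : ℕ) (A B : Fin n → Fin n → Bool) (k : ℕ) : Instance w :=
  ⟨initialRel w (2 * n + 2) (LeftTuple A) k, initialRel w (2 * n + 2) (RightTuple B) k⟩

/-! ## Correctness of the construction -/

section Setup

variable {w : ℕ}

@[simp] theorem State.reg_setReg (s : State w) (x y : ℕ) (v : BitVec w) :
    (s.setReg x v).reg y = if y = x then v else s.reg y := by
  simp [State.setReg, Function.update_apply]

@[simp] theorem State.arr_setReg (s : State w) (x : ℕ) (v : BitVec w) :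
    (s.setReg x v).arr = s.arr := rfl

@[simp] theorem State.reg_setArr (s : State w) (a : ℕ) (i j v : BitVec w) :
    (s.setArr a i j v).reg = s.reg := rfl

theorem card_insert_of_lexLt {R : Finset (BitVec w × BitVec w)} {i j : BitVec w}
    (h : ∀ q ∈ R, LexLt q (i, j)) : (insert (i, j) R).card = R.card + 1 := by
  rw [← length_tuples, tuples_insert h]
  simp [length_tuples]

variable {O : Type}

/-- The seven stores are the cell changes in the `_insert` lemmas for the six tables of `R₁`, two of
them for the tuple table. All other tables belong to `R₂` or are unused, and stay as they are. -/
theorem exec_appendTuple_zero {s : State w} {R₁ R₂ : Finset (BitVec w × BitVec w)} {i j : BitVec w}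
    (hs : s.sub = samplerInput ⟨R₁, R₂⟩) (h4 : s.reg 4 = BitVec.ofNat w 1)
    (h6 : s.reg 6 = BitVec.ofNat w 0) (hi : s.reg 10 = i) (hj : s.reg 12 = j)
    (h : ∀ q ∈ R₁, LexLt q (i, j)) (hw : 1 < 2 ^ w) (hR : R₁.card < 2 ^ w) :
    ((appendTuple 0 : Cmd O).exec s).sub = samplerInput ⟨insert (i, j) R₁, R₂⟩ := by
  have hr : ∀ x, s.reg (2 * x + 1) = (samplerInput ⟨R₁, R₂⟩).reg x := fun x => by rw [← hs]; rfl
  have ha : ∀ x, s.arr (2 * x + 1) = (samplerInput ⟨R₁, R₂⟩).arr x := fun x => by rw [← hs]; rfl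
  have hr0 := hr 0
  have ha0 := ha 0
  have ha2 := ha 2
  have ha4 := ha 4
  have ha5 := ha 5
  have ha8 := ha 8
  have ha9 := ha 9
  simp only [samplerInput, Nat.reduceMul, Nat.reduceAdd] at hr0 ha0 ha2 ha4 ha5 ha8 ha9
  refine State.ext (funext fun x => ?_) (funext fun a => ?_)
  · simp only [State.sub, appendTuple, block, Cmd.exec, State.arr_setReg, State.reg_setReg,
      State.reg_setArr, BinOp.eval, Nat.reduceMul, Nat.reduceAdd, Nat.reduceEqDiff,
      if_true, if_false, hr0, h4]
    rcases x with _ | _ | x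
    · simp [samplerInput, card_insert_of_lexLt h, BitVec.ofNat_add]
    · simpa [samplerInput, card_insert_of_lexLt h, BitVec.ofNat_add] using hr 1
    · repeat rw [if_neg (by omega)]
      exact hr (x + 2)
  · simp only [State.sub, appendTuple, block, Cmd.exec, State.arr_setReg, State.reg_setReg,
      State.reg_setArr, State.arr_setArr, BinOp.eval, Nat.reduceMul, Nat.reduceAdd, Nat.reduceEqDiff,
      if_true, if_false, hr0, ha0, ha2, ha4, ha5, ha8, ha9, hi, hj, h4, h6]
    rcases a with _ | _ | _ | _ | _ | _ | _ | _ | _ | _ | _ | _ | a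
    -- The sampler input uses only arrays `0` to `11`.
    case succ.succ.succ.succ.succ.succ.succ.succ.succ.succ.succ.succ =>
      rw [if_neg (by omega), if_neg (by omega), if_neg (by omega), if_neg (by omega),
        if_neg (by omega), if_neg (by omega), if_neg (by omega)]
      exact ha (a + 12)
    all_goals
      simp only [Nat.reduceMul, Nat.reduceAdd, Nat.reduceEqDiff, if_true, if_false]
      first
        | exact ha 1
        | exact ha 3
        | exact ha 6
        | exact ha 7
        | exact ha 10
        | exact ha 11
        | exact (tupleTable_insert h hw hR).symm
        | exact memTable_insert.symm
        | exact (len_nbrsFst_insert h).symm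
        | exact (len_nbrsSnd_insert h).symm
        | exact (nth_nbrsFst_insert h).symm
        | exact (nth_nbrsSnd_insert h).symm

theorem exec_appendTuple_one {s : State w} {R₁ R₂ : Finset (BitVec w × BitVec w)} {i j : BitVec w}
    (hs : s.sub = samplerInput ⟨R₁, R₂⟩) (h4 : s.reg 4 = BitVec.ofNat w 1)
    (h6 : s.reg 6 = BitVec.ofNat w 0) (hi : s.reg 10 = i) (hj : s.reg 12 = j)
    (h : ∀ q ∈ R₂, LexLt q (i, j)) (hw : 1 < 2 ^ w) (hR : R₂.card < 2 ^ w) :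
    ((appendTuple 1 : Cmd O).exec s).sub = samplerInput ⟨R₁, insert (i, j) R₂⟩ := by
  have hr : ∀ x, s.reg (2 * x + 1) = (samplerInput ⟨R₁, R₂⟩).reg x := fun x => by rw [← hs]; rfl
  have ha : ∀ x, s.arr (2 * x + 1) = (samplerInput ⟨R₁, R₂⟩).arr x := fun x => by rw [← hs]; rfl
  have hr1 := hr 1
  have ha1 := ha 1
  have ha3 := ha 3
  have ha6 := ha 6
  have ha7 := ha 7
  have ha10 := ha 10
  have ha11 := ha 11
  simp only [samplerInput, Nat.reduceMul, Nat.reduceAdd] at hr1 ha1 ha3 ha6 ha7 ha10 ha11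
  refine State.ext (funext fun x => ?_) (funext fun a => ?_)
  · simp only [State.sub, appendTuple, block, Cmd.exec, State.arr_setReg, State.reg_setReg,
      State.reg_setArr, BinOp.eval, Nat.reduceMul, Nat.reduceAdd, Nat.reduceEqDiff,
      if_true, if_false, hr1, h4]
    rcases x with _ | _ | x
    · simpa [samplerInput, card_insert_of_lexLt h, BitVec.ofNat_add] using hr 0
    · simp [samplerInput, card_insert_of_lexLt h, BitVec.ofNat_add]
    · repeat rw [if_neg (by omega)]
      exact hr (x + 2)
  · simp only [State.sub, appendTuple, block, Cmd.exec, State.arr_setReg, State.reg_setReg,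
      State.reg_setArr, State.arr_setArr, BinOp.eval, Nat.reduceMul, Nat.reduceAdd, Nat.reduceEqDiff,
      if_true, if_false, hr1, ha1, ha3, ha6, ha7, ha10, ha11, hi, hj, h4, h6]
    rcases a with _ | _ | _ | _ | _ | _ | _ | _ | _ | _ | _ | _ | a
    case succ.succ.succ.succ.succ.succ.succ.succ.succ.succ.succ.succ =>
      rw [if_neg (by omega), if_neg (by omega), if_neg (by omega), if_neg (by omega),
        if_neg (by omega), if_neg (by omega), if_neg (by omega)]
      exact ha (a + 12)
    all_goals
      simp only [Nat.reduceMul, Nat.reduceAdd, Nat.reduceEqDiff, if_true, if_false]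
      first
        | exact ha 0
        | exact ha 2
        | exact ha 4
        | exact ha 5
        | exact ha 8
        | exact ha 9
        | exact (tupleTable_insert h hw hR).symm
        | exact memTable_insert.symm
        | exact (len_nbrsFst_insert h).symm
        | exact (len_nbrsSnd_insert h).symm
        | exact (nth_nbrsFst_insert h).symm
        | exact (nth_nbrsSnd_insert h).symm


theorem reg_exec_appendTuple (s : State w) (ρ x : ℕ) (hx : x ≠ 11) :
    ((appendTuple ρ : Cmd O).exec s).reg (2 * x) = s.reg (2 * x) := by
  simp only [appendTuple, block, Cmd.exec, State.reg_setReg, State.reg_setArr]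
  rw [if_neg (by omega), if_neg (by omega), if_neg (by omega), if_neg (by omega), if_neg (by omega)]

theorem arr_exec_appendTuple (s : State w) (ρ a : ℕ) :
    ((appendTuple ρ : Cmd O).exec s).arr (2 * a) = s.arr (2 * a) := by
  simp only [appendTuple, block, Cmd.exec, State.arr_setReg, State.arr_setArr]
  rw [if_neg (by omega), if_neg (by omega), if_neg (by omega), if_neg (by omega), if_neg (by omega),
    if_neg (by omega), if_neg (by omega)]

theorem reg_exec_testTuple (s : State w) (a x y z : ℕ) (h : z ≠ 18 ∧ z ≠ 20 ∧ z ≠ 22) :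
    ((testTuple a x y : Cmd O).exec s).reg z = s.reg z := by
  simp [testTuple, block, Cmd.exec, h]

theorem arr_exec_testTuple (s : State w) (a x y : ℕ) :
    ((testTuple a x y : Cmd O).exec s).arr = s.arr := by
  simp [testTuple, block, Cmd.exec]

/-- The bound on `w` excludes words of zero bits, where `1 = 0` and the test would be meaningless.
-/
theorem bit_or_and_eq_zero (hw : 1 < 2 ^ w) (a b c : Prop) [Decidable a] [Decidable b]
    [Decidable c] : (if a then BitVec.ofNat w 1 else BitVec.ofNat w 0) |||
      ((if b then BitVec.ofNat w 1 else BitVec.ofNat w 0) &&&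
        (if c then BitVec.ofNat w 1 else BitVec.ofNat w 0)) = 0 ↔ ¬ (a ∨ (b ∧ c)) := by
  have h : BitVec.ofNat w 1 ≠ 0#w := by
    rw [Ne, ← BitVec.toNat_inj, BitVec.toNat_ofNat, Nat.mod_eq_of_lt hw]
    simp
  by_cases a <;> by_cases b <;> by_cases c <;> simp_all

/-- The memory during the construction of the instance. -/
structure Ready {n : ℕ} (A B : Fin n → Fin n → Bool) (I : Instance w) (i j q c : ℕ)
    (s : State w) : Prop where
  sub : s.sub = samplerInput I
  regN : s.reg 0 = BitVec.ofNat w n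
  regP : s.reg 2 = BitVec.ofNat w (2 * n + 2)
  regOne : s.reg 4 = BitVec.ofNat w 1
  regZero : s.reg 6 = BitVec.ofNat w 0
  regI : s.reg 10 = BitVec.ofNat w i
  regJ : s.reg 12 = BitVec.ofNat w j
  regQ : s.reg 14 = BitVec.ofNat w q
  regC : s.reg 16 = BitVec.ofNat w c
  arrA : s.arr 0 = entry w A
  arrB : s.arr 2 = entry w B
  arrOut : s.arr 4 = fun _ _ => BitVec.ofNat w 0

section Ready

variable {n : ℕ} {A B : Fin n → Fin n → Bool} {I : Instance w} {i j q c : ℕ} {s : State w}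

theorem Ready.exec_testTuple (h : Ready A B I i j q c s) (a x y : ℕ) :
    Ready A B I i j q c ((testTuple a x y : Cmd O).exec s) where
  sub := by
    rw [← h.sub]
    refine State.ext (funext fun z => ?_) (funext fun z => ?_)
    · exact reg_exec_testTuple _ _ _ _ _ (by omega)
    · simp [State.sub, arr_exec_testTuple]
  regN := by rw [reg_exec_testTuple _ _ _ _ _ (by omega), h.regN]
  regP := by rw [reg_exec_testTuple _ _ _ _ _ (by omega), h.regP]
  regOne := by rw [reg_exec_testTuple _ _ _ _ _ (by omega), h.regOne]
  regZero := by rw [reg_exec_testTuple _ _ _ _ _ (by omega), h.regZero]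
  regI := by rw [reg_exec_testTuple _ _ _ _ _ (by omega), h.regI]
  regJ := by rw [reg_exec_testTuple _ _ _ _ _ (by omega), h.regJ]
  regQ := by rw [reg_exec_testTuple _ _ _ _ _ (by omega), h.regQ]
  regC := by rw [reg_exec_testTuple _ _ _ _ _ (by omega), h.regC]
  arrA := by rw [arr_exec_testTuple, h.arrA]
  arrB := by rw [arr_exec_testTuple, h.arrB]
  arrOut := by rw [arr_exec_testTuple, h.arrOut]

theorem Ready.exec_appendTuple (h : Ready A B I i j q c s) (ρ : ℕ) {I' : Instance w}
    (hI' : ((appendTuple ρ : Cmd O).exec s).sub = samplerInput I') :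
    Ready A B I' i j q c ((appendTuple ρ : Cmd O).exec s) where
  sub := hI'
  regN := (reg_exec_appendTuple s ρ 0 (by omega)).trans h.regN
  regP := (reg_exec_appendTuple s ρ 1 (by omega)).trans h.regP
  regOne := (reg_exec_appendTuple s ρ 2 (by omega)).trans h.regOne
  regZero := (reg_exec_appendTuple s ρ 3 (by omega)).trans h.regZero
  regI := (reg_exec_appendTuple s ρ 5 (by omega)).trans h.regI
  regJ := (reg_exec_appendTuple s ρ 6 (by omega)).trans h.regJ
  regQ := (reg_exec_appendTuple s ρ 7 (by omega)).trans h.regQ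
  regC := (reg_exec_appendTuple s ρ 8 (by omega)).trans h.regC
  arrA := (arr_exec_appendTuple s ρ 0).trans h.arrA
  arrB := (arr_exec_appendTuple s ρ 1).trans h.arrB
  arrOut := (arr_exec_appendTuple s ρ 2).trans h.arrOut

theorem entry_eq_ite (A : Fin n → Fin n → Bool) {x y : ℕ} (hx : x < 2 ^ w) (hy : y < 2 ^ w)
    [Decidable (∃ (hx : x < n) (hy : y < n), A ⟨x, hx⟩ ⟨y, hy⟩ = true)] :
    entry w A (BitVec.ofNat w x) (BitVec.ofNat w y) =
      if ∃ (hx : x < n) (hy : y < n), A ⟨x, hx⟩ ⟨y, hy⟩ = true then BitVec.ofNat w 1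
      else BitVec.ofNat w 0 := by
  simp only [entry, BitVec.toNat_ofNat, Nat.mod_eq_of_lt hx, Nat.mod_eq_of_lt hy, bit]
  by_cases h : x < n ∧ y < n
  · simp [h]
  · rw [dif_neg h, if_neg]
    rintro ⟨h1, h2, -⟩
    exact h ⟨h1, h2⟩

theorem ofNat_eq_iff {x y : ℕ} (hx : x < 2 ^ w) (hy : y < 2 ^ w) :
    BitVec.ofNat w x = BitVec.ofNat w y ↔ x = y := by
  rw [← BitVec.toNat_inj, BitVec.toNat_ofNat, BitVec.toNat_ofNat, Nat.mod_eq_of_lt hx,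
    Nat.mod_eq_of_lt hy]

theorem Ready.testTuple_left (h : Ready A B I i j q c s) (hw : 1 < 2 ^ w) (hn : n < 2 ^ w)
    (hi : i < 2 ^ w) (hj : j < 2 ^ w) :
    ((testTuple 0 12 10 : Cmd O).exec s).reg 18 = 0 ↔ ¬ LeftTuple A i j := by
  classical
  simp only [testTuple, block, Cmd.exec, BinOp.eval, State.reg_setReg, h.arrA, h.regI,
    h.regJ, h.regN, Nat.reduceEqDiff, if_true, if_false, entry_eq_ite A hi hj, ofNat_eq_iff hj hn,
    BitVec.toNat_ofNat, Nat.mod_eq_of_lt hn, Nat.mod_eq_of_lt hi]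
  exact bit_or_and_eq_zero hw _ _ _

theorem Ready.testTuple_right (h : Ready A B I i j q c s) (hw : 1 < 2 ^ w) (hn : n < 2 ^ w)
    (hi : i < 2 ^ w) (hj : j < 2 ^ w) :
    ((testTuple 2 10 12 : Cmd O).exec s).reg 18 = 0 ↔ ¬ RightTuple B i j := by
  classical
  simp only [testTuple, block, Cmd.exec, BinOp.eval, State.reg_setReg, h.arrB, h.regI,
    h.regJ, h.regN, Nat.reduceEqDiff, if_true, if_false, entry_eq_ite B hi hj, ofNat_eq_iff hi hn,
    BitVec.toNat_ofNat, Nat.mod_eq_of_lt hn, Nat.mod_eq_of_lt hj]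
  exact bit_or_and_eq_zero hw _ _ _

end Ready

end Setup
-- Execution of the construction: filling loop, binary length, number of samples
section Setup

variable {w : ℕ} {O : Type}

theorem State.sub_setReg_even (s : State w) (x : ℕ) (v : BitVec w) :
    (s.setReg (2 * x) v).sub = s.sub := by
  refine State.ext (funext fun y => ?_) rfl
  simp only [State.sub, State.reg_setReg]
  rw [if_neg (by omega)]

section Fill

variable {n : ℕ} {A B : Fin n → Fin n → Bool} {I : Instance w} {i j q c : ℕ} {s : State w}

theorem Ready.setIndices (h : Ready A B I i j q c s) (i' j' : ℕ) :
    Ready A B I i' j' q c ((s.setReg 10 (BitVec.ofNat w i')).setReg 12 (BitVec.ofNat w j')) where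
  sub := by
    rw [State.sub_setReg_even _ 6, State.sub_setReg_even _ 5, h.sub]
  regN := by simpa using h.regN
  regP := by simpa using h.regP
  regOne := by simpa using h.regOne
  regZero := by simpa using h.regZero
  regI := by simp
  regJ := by simp
  regQ := by simpa using h.regQ
  regC := by simpa using h.regC
  arrA := h.arrA
  arrB := h.arrB
  arrOut := h.arrOut

theorem Ready.setCounters (h : Ready A B I i j q c s) (q' c' : ℕ) :
    Ready A B I i j q' c' ((s.setReg 14 (BitVec.ofNat w q')).setReg 16 (BitVec.ofNat w c')) where
  sub := by
    rw [State.sub_setReg_even _ 8, State.sub_setReg_even _ 7, h.sub]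
  regN := by simpa using h.regN
  regP := by simpa using h.regP
  regOne := by simpa using h.regOne
  regZero := by simpa using h.regZero
  regI := by simpa using h.regI
  regJ := by simpa using h.regJ
  regQ := by simp
  regC := by simp
  arrA := h.arrA
  arrB := h.arrB
  arrOut := h.arrOut

theorem ofNat_sub_one {c : ℕ} (hc : c ≠ 0) :
    BitVec.ofNat w c - BitVec.ofNat w 1 = BitVec.ofNat w (c - 1) := by
  obtain ⟨c, rfl⟩ := Nat.exists_eq_succ_of_ne_zero hc
  simp [BitVec.ofNat_add]

/-- Since `hN` bounds all codes by the word range, word division and remainder by `2n + 2` decode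
the counter `k` into the next pair; that pair exceeds everything stored so far, as the append lemmas
require. -/
theorem Ready.exec_fillBody (hN : (2 * n + 2) * (2 * n + 2) < 2 ^ w) {k : ℕ}
    (hk : k < (2 * n + 2) * (2 * n + 2))
    (h : Ready A B (initialInstance w A B k) i j k c s) (hc : c ≠ 0) :
    Ready A B (initialInstance w A B (k + 1)) (k / (2 * n + 2)) (k % (2 * n + 2)) (k + 1) (c - 1)
      ((fillBody : Cmd O).exec s) := by
  classical
  have hP : 2 * n + 2 < 2 ^ w := lt_of_le_of_lt (Nat.le_mul_of_pos_left _ (by omega)) hN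
  have hd : k / (2 * n + 2) < 2 * n + 2 := Nat.div_lt_of_lt_mul hk
  have hm : k % (2 * n + 2) < 2 * n + 2 := Nat.mod_lt _ (by omega)
  have hdiv : BitVec.ofNat w k / BitVec.ofNat w (2 * n + 2) = BitVec.ofNat w (k / (2 * n + 2)) := by
    rw [← BitVec.toNat_inj]
    simp only [BitVec.toNat_udiv, BitVec.toNat_ofNat]
    rw [Nat.mod_eq_of_lt hP, Nat.mod_eq_of_lt (hk.trans hN), Nat.mod_eq_of_lt (hd.trans hP)]
  have hmod : BitVec.ofNat w k % BitVec.ofNat w (2 * n + 2) = BitVec.ofNat w (k % (2 * n + 2)) := by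
    rw [← BitVec.toNat_inj]
    simp only [BitVec.toNat_umod, BitVec.toNat_ofNat]
    rw [Nat.mod_eq_of_lt hP, Nat.mod_eq_of_lt (hk.trans hN), Nat.mod_eq_of_lt (hm.trans hP)]
  have hcard : ∀ p, (initialRel w (2 * n + 2) p k).card < 2 ^ w := fun p =>
    card_initialRel_le.trans_lt (hk.trans hN)
  set i' := k / (2 * n + 2)
  set j' := k % (2 * n + 2)
  have h1 := h.setIndices i' j'
  set s1 := (s.setReg 10 (BitVec.ofNat w i')).setReg 12 (BitVec.ofNat w j') with hs1
  have h2 := h1.exec_testTuple (O := O) 0 12 10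
  have h2t := h1.testTuple_left (O := O) (by omega) (by omega) (hd.trans hP) (hm.trans hP)
  set s2 := (testTuple 0 12 10 : Cmd O).exec s1
  have h3 : Ready A B ⟨initialRel w (2 * n + 2) (LeftTuple A) (k + 1),
      initialRel w (2 * n + 2) (RightTuple B) k⟩ i' j' k c
      ((Cmd.ite 18 (appendTuple 0) .skip : Cmd O).exec s2) := by
    rw [initialRel_succ hP.le hk, Cmd.exec]
    by_cases ht : LeftTuple A i' j'
    · rw [if_pos ht, if_neg (by rw [h2t]; simpa using ht)]
      exact h2.exec_appendTuple 0 (exec_appendTuple_zero h2.sub h2.regOne h2.regZero h2.regI h2.regJ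
        (fun q hq => lexLt_of_mem_initialRel hP.le hk hq) (by omega) (hcard _))
    · rw [if_neg ht, if_pos (by rw [h2t]; exact ht)]
      exact h2
  set s3 := (Cmd.ite 18 (appendTuple 0) .skip : Cmd O).exec s2
  have h4 := h3.exec_testTuple (O := O) 2 10 12
  have h4t := h3.testTuple_right (O := O) (by omega) (by omega) (hd.trans hP) (hm.trans hP)
  set s4 := (testTuple 2 10 12 : Cmd O).exec s3
  have h5 : Ready A B (initialInstance w A B (k + 1)) i' j' k c
      ((Cmd.ite 18 (appendTuple 1) .skip : Cmd O).exec s4) := by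
    rw [initialInstance, initialRel_succ (p := RightTuple B) hP.le hk, Cmd.exec]
    by_cases ht : RightTuple B i' j'
    · rw [if_pos ht, if_neg (by rw [h4t]; simpa using ht)]
      exact h4.exec_appendTuple 1 (exec_appendTuple_one h4.sub h4.regOne h4.regZero h4.regI h4.regJ
        (fun q hq => lexLt_of_mem_initialRel hP.le hk hq) (by omega) (hcard _))
    · rw [if_neg ht, if_pos (by rw [h4t]; exact ht)]
      exact h4
  set s5 := (Cmd.ite 18 (appendTuple 1) .skip : Cmd O).exec s4 with hs5
  have h6 := h5.setCounters (k + 1) (c - 1)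
  have e1 : (Cmd.op .mod 12 14 2 : Cmd O).exec ((Cmd.op .div 10 14 2 : Cmd O).exec s) = s1 := by
    simp [Cmd.exec, BinOp.eval, h.regQ, h.regP, hdiv, hmod, hs1]
  have e2 : (Cmd.op .sub 16 16 4 : Cmd O).exec ((Cmd.op .add 14 14 4 : Cmd O).exec s5) =
      (s5.setReg 14 (BitVec.ofNat w (k + 1))).setReg 16 (BitVec.ofNat w (c - 1)) := by
    simp only [Cmd.exec, BinOp.eval, h5.regQ, h5.regC, h5.regOne, State.reg_setReg,
      Nat.reduceEqDiff, if_false, BitVec.ofNat_add, ofNat_sub_one hc]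
  have e : (fillBody : Cmd O).exec s = (Cmd.op .sub 16 16 4 : Cmd O).exec
      ((Cmd.op .add 14 14 4 : Cmd O).exec ((Cmd.ite 18 (appendTuple 1) .skip : Cmd O).exec
      ((testTuple 2 10 12 : Cmd O).exec ((Cmd.ite 18 (appendTuple 0) .skip : Cmd O).exec
      ((testTuple 0 12 10 : Cmd O).exec
      ((Cmd.op .mod 12 14 2 : Cmd O).exec ((Cmd.op .div 10 14 2 : Cmd O).exec s))))))) := rfl
  rw [e, e1, ← hs5, e2]
  exact h6

/-- The matrices lie under even names, so the memory visible to the sampler is zero everywhere,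
which is precisely the encoding of the empty instance. -/
theorem exec_initCode (A B : Fin n → Fin n → Bool) :
    ∃ i j, Ready A B (initialInstance w A B 0) i j 0 ((2 * n + 2) * (2 * n + 2))
      ((initCode : Cmd O).exec (bmmInput w A B)) := by
  refine ⟨0, 0, ?_⟩
  have hsub : (bmmInput w A B).sub = samplerInput (initialInstance w A B 0) := by
    simp only [initialInstance, initialRel_zero]
    have ht : tuples (∅ : Finset (BitVec w × BitVec w)) = [] := by simp [tuples]
    have hf : ∀ x, nbrsFst (∅ : Finset (BitVec w × BitVec w)) x = [] := by simp [nbrsFst]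
    have hs : ∀ x, nbrsSnd (∅ : Finset (BitVec w × BitVec w)) x = [] := by simp [nbrsSnd]
    refine State.ext (funext fun x => ?_) (funext fun a => funext fun x => funext fun y => ?_)
    · rcases x with _ | _ | x <;> simp [State.sub, samplerInput, bmmInput]
    · have : (bmmInput w A B).sub.arr a x y = BitVec.ofNat w 0 := by
        simp only [State.sub, bmmInput]
        split
        · omega
        · omega
        · rfl
      rw [this]
      rcases a with _ | _ | _ | _ | _ | _ | _ | _ | _ | _ | _ | _ | a <;>
        simp [samplerInput, tupleTable, memTable, ht, hf, hs, nth, len, bit]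
  constructor
  · rw [← hsub]
    simp only [initCode, block, Cmd.exec]
    rw [State.sub_setReg_even _ 7, State.sub_setReg_even _ 8, State.sub_setReg_even _ 1,
      State.sub_setReg_even _ 1, State.sub_setReg_even _ 4, State.sub_setReg_even _ 3,
      State.sub_setReg_even _ 2]
  all_goals
    simp only [initCode, block, Cmd.exec, BinOp.eval, State.reg_setReg, State.arr_setReg, bmmInput,
      Nat.reduceEqDiff, if_true, if_false, two_mul, BitVec.ofNat_add, BitVec.ofNat_mul]

theorem straightLine_fillBody : (fillBody : Cmd O).StraightLine := by
  simp [fillBody, testTuple, appendTuple, block, Cmd.StraightLine]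

/-- The memory when preprocessing starts. -/
structure SetupDone {n : ℕ} (A B : Fin n → Fin n → Bool) (s : State w) : Prop where
  sub : s.sub = samplerInput (initialInstance w A B ((2 * n + 2) * (2 * n + 2)))
  regOne : s.reg 4 = BitVec.ofNat w 1
  regK : s.reg 28 = BitVec.ofNat w (4 * (2 * n + 2) ^ 2 * Nat.size (2 * n + 2))
  arrOut : s.arr 4 = fun _ _ => BitVec.ofNat w 0

/-- The memory during the computation of the binary length. -/
structure Sizing {n : ℕ} (A B : Fin n → Fin n → Bool) (l : ℕ) (s : State w) : Prop where
  sub : s.sub = samplerInput (initialInstance w A B ((2 * n + 2) * (2 * n + 2)))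
  regP : s.reg 2 = BitVec.ofNat w (2 * n + 2)
  regOne : s.reg 4 = BitVec.ofNat w 1
  regL : s.reg 24 = BitVec.ofNat w l
  regX : s.reg 26 = BitVec.ofNat w ((2 * n + 2) / 2 ^ l)
  arrOut : s.arr 4 = fun _ _ => BitVec.ofNat w 0

theorem Ready.exec_sizeInit
    (h : Ready A B (initialInstance w A B ((2 * n + 2) * (2 * n + 2))) i j q c s) :
    Sizing A B 0 ((sizeInit : Cmd O).exec s) where
  sub := by
    simp only [sizeInit, block, Cmd.exec]
    rw [State.sub_setReg_even _ 12, State.sub_setReg_even _ 13, h.sub]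
  regP := by simpa [sizeInit, block, Cmd.exec] using h.regP
  regOne := by simpa [sizeInit, block, Cmd.exec] using h.regOne
  regL := by simp [sizeInit, block, Cmd.exec]
  regX := by simp [sizeInit, block, Cmd.exec, BinOp.eval, h.regP, h.regZero]
  arrOut := by simpa [sizeInit, block, Cmd.exec] using h.arrOut

theorem Sizing.exec_sizeBody {l : ℕ} (h : Sizing A B l s) (hP : 2 * n + 2 < 2 ^ w) :
    Sizing A B (l + 1) ((sizeBody : Cmd O).exec s) where
  sub := by
    simp only [sizeBody, block, Cmd.exec]
    rw [State.sub_setReg_even _ 12, State.sub_setReg_even _ 13, h.sub]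
  regP := by simpa [sizeBody, block, Cmd.exec] using h.regP
  regOne := by simpa [sizeBody, block, Cmd.exec] using h.regOne
  regL := by simp [sizeBody, block, Cmd.exec, BinOp.eval, h.regL, h.regOne, BitVec.ofNat_add]
  regX := by
    simp only [sizeBody, block, Cmd.exec, BinOp.eval, State.reg_setReg, Nat.reduceEqDiff, if_true,
      if_false, h.regX, h.regOne]
    rw [← BitVec.toNat_inj]
    have h1 : (BitVec.ofNat w 1).toNat = 1 := by
      rw [BitVec.toNat_ofNat, Nat.mod_eq_of_lt (by omega)]
    have h2 : ∀ m, (2 * n + 2) / m < 2 ^ w := fun m => (Nat.div_le_self _ _).trans_lt hP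
    rw [h1, BitVec.toNat_ushiftRight, BitVec.toNat_ofNat, BitVec.toNat_ofNat,
      Nat.mod_eq_of_lt (h2 _), Nat.mod_eq_of_lt (h2 _), Nat.shiftRight_eq_div_pow,
      Nat.div_div_eq_div_mul, pow_succ 2 l, pow_one]
  arrOut := by simpa [sizeBody, block, Cmd.exec] using h.arrOut

theorem Sizing.exec_countCode (h : Sizing A B (Nat.size (2 * n + 2)) s) :
    SetupDone A B ((countCode : Cmd O).exec s) where
  sub := by
    simp only [countCode, block, Cmd.exec]
    rw [State.sub_setReg_even _ 14, State.sub_setReg_even _ 10, State.sub_setReg_even _ 14,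
      State.sub_setReg_even _ 14, h.sub]
  regOne := by simpa [countCode, block, Cmd.exec] using h.regOne
  regK := by
    simp only [countCode, block, Cmd.exec, BinOp.eval, State.reg_setReg, Nat.reduceEqDiff, if_true,
      if_false, h.regP, h.regL, ← BitVec.ofNat_mul]
    congr 1
    ring
  arrOut := by simpa [countCode, block, Cmd.exec] using h.arrOut

theorem reaches_size (F : Oracle O w) (hP : 2 * n + 2 < 2 ^ w) (k : List (Cmd O))
    (hs : Sizing A B 0 s) :
    Reaches F (fun c => ∃ s, c = (k, s) ∧ SetupDone A B s) (Nat.size (2 * n + 2) * 6 + 11)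
      (.seq (.loop 26 sizeBody) countCode :: k, s) := by
  have hsbody : (sizeBody : Cmd O).StraightLine := by simp [sizeBody, block, Cmd.StraightLine]
  have hcount : (countCode : Cmd O).StraightLine := by simp [countCode, block, Cmd.StraightLine]
  have hloop := Reaches.loop (F := F) (x := 26) (c := sizeBody) (k := countCode :: k) (fun l s => Sizing A B l s)
    (m := Nat.size (2 * n + 2)) (t := (sizeBody : Cmd O).steps) ?_ ?_ hs
  -- Five steps of `sizeBody` and one test per round, one final test, nine steps of `countCode`; the
  -- `seq` itself is the eleventh extra step.
  · refine Reaches.seq (t := Nat.size (2 * n + 2) * 6 + 1 + (9 + 0)) (hloop.trans ?_)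
    rintro _ ⟨s, rfl, hs⟩
    exact Reaches.straightLine hcount (.here _ _ ⟨_, rfl, hs.exec_countCode⟩)
  · intro l hl s hs
    refine ⟨?_, ?_⟩
    · rw [hs.regX, Ne, ← BitVec.toNat_inj, BitVec.toNat_ofNat,
        Nat.mod_eq_of_lt ((Nat.div_le_self _ _).trans_lt hP)]
      -- For `l` below the binary length, `2 ^ l ≤ 2 * n + 2`, so the shifted value is still
      -- positive and the loop goes on.
      have := Nat.div_pos (Nat.lt_size.1 hl) (by positivity)
      simp only [BitVec.ofNat_eq_ofNat, BitVec.toNat_ofNat, Nat.zero_mod]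
      omega
    · refine (hsbody.reaches _ _).trans (u := 0) ?_
      rintro _ rfl
      exact .here _ _ ⟨_, rfl, hs.exec_sizeBody hP⟩
  · intro s hs
    rw [hs.regX, Nat.div_eq_of_lt (Nat.lt_size_self _)]
    rfl

theorem reaches_fill (F : Oracle O w) (hN : (2 * n + 2) * (2 * n + 2) < 2 ^ w) (k : List (Cmd O))
    (hs : ∃ i j, Ready A B (initialInstance w A B 0) i j 0 ((2 * n + 2) * (2 * n + 2)) s) :
    Reaches F (fun c => ∃ s, c = (k, s) ∧ ∃ i j, Ready A B
        (initialInstance w A B ((2 * n + 2) * (2 * n + 2))) i j ((2 * n + 2) * (2 * n + 2)) 0 s)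
      ((2 * n + 2) * (2 * n + 2) * 90 + 1) (.loop 16 fillBody :: k, s) := by
  have hloop := Reaches.loop (F := F) (x := 16) (c := fillBody) (k := k) (fun k s => ∃ i j, Ready A B
    (initialInstance w A B k) i j k ((2 * n + 2) * (2 * n + 2) - k) s)
    (m := (2 * n + 2) * (2 * n + 2)) (t := (fillBody : Cmd O).steps) ?_ ?_ hs
  · have e : (fillBody : Cmd O).steps = 89 := by
      simp [fillBody, testTuple, appendTuple, block, Cmd.steps]
    rw [Nat.sub_self, e] at hloop
    exact hloop
  · rintro k hk s ⟨i, j, hs⟩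
    refine ⟨?_, ?_⟩
    · rw [hs.regC, Ne, ← BitVec.toNat_inj, BitVec.toNat_ofNat, Nat.mod_eq_of_lt (by omega)]
      simp only [BitVec.ofNat_eq_ofNat, BitVec.toNat_ofNat, Nat.zero_mod]
      omega
    · refine (straightLine_fillBody.reaches _ _).trans (u := 0) ?_
      rintro _ rfl
      refine .here _ _ ⟨_, rfl, k / (2 * n + 2), k % (2 * n + 2), ?_⟩
      have := hs.exec_fillBody (O := O) hN hk (by omega)
      rwa [Nat.sub_sub] at this
  · rintro s ⟨i, j, hs⟩
    rw [hs.regC, Nat.sub_self]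
    rfl

/-- A bound on the number of steps of the construction. -/
def setupSteps (n : ℕ) : ℕ :=
  (2 * n + 2) * (2 * n + 2) * 90 + Nat.size (2 * n + 2) * 6 + 35

theorem reaches_setup (F : Oracle O w) (A B : Fin n → Fin n → Bool)
    (hN : (2 * n + 2) * (2 * n + 2) < 2 ^ w) (k : List (Cmd O)) :
    Reaches F (fun c => ∃ s, c = (k, s) ∧ SetupDone A B s) (setupSteps n)
      (setup :: k, bmmInput w A B) := by
  have hP : 2 * n + 2 < 2 ^ w := lt_of_le_of_lt (Nat.le_mul_of_pos_left _ (by omega)) hN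
  have hinit : (initCode : Cmd O).StraightLine := by simp [initCode, block, Cmd.StraightLine]
  have hsinit : (sizeInit : Cmd O).StraightLine := by simp [sizeInit, block, Cmd.StraightLine]
  have h2 : ∀ c : Config O w, (∃ s, c = (.seq sizeInit (.seq (.loop 26 sizeBody) countCode) :: k, s) ∧
      ∃ i j, Ready A B (initialInstance w A B ((2 * n + 2) * (2 * n + 2))) i j
        ((2 * n + 2) * (2 * n + 2)) 0 s) →
      Reaches F (fun c => ∃ s, c = (k, s) ∧ SetupDone A B s)
        (5 + (Nat.size (2 * n + 2) * 6 + 11) + 1) c := by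
    rintro _ ⟨s, rfl, i, j, hs⟩
    exact Reaches.seq (Reaches.straightLine hsinit (reaches_size F hP k hs.exec_sizeInit))
  have h1 := (reaches_fill F hN (.seq sizeInit (.seq (.loop 26 sizeBody) countCode) :: k)
    (exec_initCode (O := O) (w := w) A B)).trans h2
  refine Reaches.mono (Reaches.seq (Reaches.straightLine hinit (Reaches.seq h1))) ?_
  have : (initCode : Cmd O).steps = 15 := rfl
  unfold setupSteps
  omega

end Fill

end Setup
/-! ## Overhead of the reduction -/

theorem size_le_three_mul_log (n : ℕ) : Nat.size (2 * n + 2) ≤ 3 * Nat.log 2 (n + 2) := by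
  have h1 : 1 ≤ Nat.log 2 (n + 2) := Nat.log_pos (by norm_num) (by omega)
  have h2 : n + 2 < 2 ^ (Nat.log 2 (n + 2) + 1) := Nat.lt_pow_succ_log_self (by norm_num) _
  rw [Nat.size_le]
  calc 2 * n + 2 < 2 ^ (Nat.log 2 (n + 2) + 2) := by rw [pow_succ]; omega
    -- The logarithm is at least `1`, so it absorbs the additive `2`.
    _ ≤ 2 ^ (3 * Nat.log 2 (n + 2)) := Nat.pow_le_pow_right (by norm_num) (by omega)

theorem size_le_self (n : ℕ) : Nat.size n ≤ n := by
  rw [Nat.size_le]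
  exact Nat.lt_two_pow_self

/-- The number of samples. -/
def numSamples (n : ℕ) : ℕ := 4 * (2 * n + 2) ^ 2 * Nat.size (2 * n + 2)

/-- The crude bound `32 (n + 1)³` suffices: `(n + 2) ^ 5` pays for the factor `32`. This keeps the
sample counter from wrapping around. -/
theorem numSamples_lt {n m : ℕ} (h : (n + 2) ^ 8 ≤ m) : numSamples n < m := by
  refine lt_of_lt_of_le ?_ h
  calc numSamples n ≤ 4 * (2 * n + 2) ^ 2 * (2 * n + 2) := by
        unfold numSamples; gcongr; exact size_le_self _
    _ = 2 ^ 5 * (n + 1) ^ 3 := by ring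
    _ < (n + 2) ^ 5 * (n + 2) ^ 3 := by
        refine Nat.mul_lt_mul_of_le_of_lt ?_ ?_ (by positivity)
        · exact Nat.pow_le_pow_left (by omega) _
        · exact Nat.pow_lt_pow_left (by omega) (by norm_num)
    _ = (n + 2) ^ 8 := by ring

theorem pairs_lt {n m : ℕ} (h : (n + 2) ^ 8 ≤ m) : (2 * n + 2) * (2 * n + 2) < m := by
  refine lt_of_lt_of_le ?_ h
  calc (2 * n + 2) * (2 * n + 2) = 2 ^ 2 * (n + 1) ^ 2 := by ring
    _ < (n + 2) ^ 6 * (n + 2) ^ 2 := by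
        refine Nat.mul_lt_mul_of_le_of_lt ?_ ?_ (by positivity)
        · calc 2 ^ 2 ≤ (n + 2) ^ 2 := Nat.pow_le_pow_left (by omega) _
            _ ≤ (n + 2) ^ 6 := Nat.pow_le_pow_right (by omega) (by norm_num)
        · exact Nat.pow_lt_pow_left (by omega) (by norm_num)
    _ = (n + 2) ^ 8 := by ring

theorem quasilinearOverhead_samplingReduction :
    Reduction.QuasilinearOverhead samplingReduction := by
  refine ⟨8, 1000, 1, fun w n A B hw F hF => Reaches.halted ?_⟩
  have hK := numSamples_lt hw
  have hN := pairs_lt hw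
  -- The loop relies only on the constant `1` and the sample counter, both under even names.
  -- Arbitrary sampler outputs merely affect which cell is marked.
  have hreg : ∀ b s, ∀ s' ∈ (F b s).support, s'.reg 4 = s.reg 4 ∧ s'.reg 28 = s.reg 28 :=
    fun b s s' hs' => ⟨(hF b s s' hs' 2).1, (hF b s s' hs' 14).1⟩
  set K := numSamples n with hKdef
  have hloop : ∀ s : State w, s.reg 4 = BitVec.ofNat w 1 → s.reg 28 = BitVec.ofNat w K →
      Reaches F (fun c => c.1 = []) (K * 6 + 1) ([samplingLoop (.call true)], s) := by
    intro s h4 h28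
    -- The body takes five steps: two `seq`, the decrement, the call and the store.
    have h := Reaches.loop (F := F) (x := 28)
      (c := .seq (.op .sub 28 28 4) (.seq (.call true) (.store 4 1 3 4))) (k := [])
      (fun i s => s.reg 4 = BitVec.ofNat w 1 ∧ s.reg 28 = BitVec.ofNat w (K - i)) (m := K) (t := 5)
      ?_ ?_ ⟨h4, h28⟩
    · refine h.trans (u := 0) ?_
      rintro _ ⟨s, rfl, -⟩
      exact .here _ _ rfl
    · rintro i hi s ⟨h4, h28⟩
      refine ⟨?_, ?_⟩
      · rw [h28, Ne, ← BitVec.toNat_inj, BitVec.toNat_ofNat, Nat.mod_eq_of_lt (by omega)]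
        simp only [BitVec.ofNat_eq_ofNat, BitVec.toNat_ofNat, Nat.zero_mod]
        omega
      · refine .seq (.of_pure rfl (.seq (.next _ _ _ _ fun c hc => ?_)))
        simp only [step, PMF.mem_support_map_iff] at hc
        obtain ⟨s', hs', rfl⟩ := hc
        refine .of_pure rfl (.here _ _ ⟨_, rfl, ?_, ?_⟩)
        · rw [State.reg_setArr, (hreg _ _ _ hs').1]
          simpa using h4
        · rw [State.reg_setArr, (hreg _ _ _ hs').2]
          simp only [State.reg_setReg, if_true, BinOp.eval, h4, h28]
          rw [ofNat_sub_one (by omega), Nat.sub_sub]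
    · rintro s ⟨-, h28⟩
      rw [h28, Nat.sub_self]
      rfl
  have h := (reaches_setup F A B hN [.seq (.call false) (samplingLoop (.call true))]).trans
    (R := fun c => c.1 = []) (u := K * 6 + 1 + 1 + 1) (by
      rintro _ ⟨s, rfl, hs⟩
      refine .seq (.next _ _ _ _ fun c hc => ?_)
      simp only [step, PMF.mem_support_map_iff] at hc
      obtain ⟨s', hs', rfl⟩ := hc
      refine hloop s' ?_ ?_
      · rw [(hreg _ _ _ hs').1, hs.regOne]
      · rw [(hreg _ _ _ hs').2, hs.regK, hKdef, numSamples])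
  refine Reaches.mono (Reaches.seq h) ?_
  have hsize := size_le_three_mul_log n
  have hlog : 1 ≤ Nat.log 2 (n + 2) := Nat.log_pos (by norm_num) (by omega)
  set L := Nat.log 2 (n + 2)
  have hX : 1 ≤ (n + 1) ^ 2 := Nat.one_le_pow _ _ (by omega)
  have e1 : (n + 1) ^ 2 ≤ (n + 1) ^ 2 * L := Nat.le_mul_of_pos_right _ hlog
  have e2 : L ≤ (n + 1) ^ 2 * L := Nat.le_mul_of_pos_left _ hX
  have e3 : (n + 1) ^ 2 * Nat.size (2 * n + 2) ≤ (n + 1) ^ 2 * (3 * L) :=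
    Nat.mul_le_mul_left _ hsize
  have e4 : numSamples n = 16 * ((n + 1) ^ 2 * Nat.size (2 * n + 2)) := by
    unfold numSamples; ring
  have e5 : setupSteps n = 360 * (n + 1) ^ 2 + Nat.size (2 * n + 2) * 6 + 35 := by
    unfold setupSteps; ring
  have e6 : (n + 1) ^ 2 * (3 * L) = 3 * ((n + 1) ^ 2 * L) := by ring
  have e7 : 1000 * (n + 1) ^ 2 * L ^ 1 = 1000 * ((n + 1) ^ 2 * L) := by ring
  omega

/-! ## Sums over lists -/

section ListSum

variable {α : Type*}

/-- The sum of `h l` over all lists `l` of length `k` with entries in `S`. -/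
noncomputable def listSum (S : Finset α) : ℕ → (List α → ℝ≥0∞) → ℝ≥0∞
  | 0, h => h []
  | k + 1, h => ∑ p ∈ S, listSum S k fun l => h (p :: l)

variable {S : Finset α}

theorem listSum_mono {k : ℕ} {g h : List α → ℝ≥0∞}
    (H : ∀ l : List α, (∀ p ∈ l, p ∈ S) → l.length = k → g l ≤ h l) :
    listSum S k g ≤ listSum S k h := by
  induction k generalizing g h with
  | zero => exact H [] (by simp) rfl
  | succ k ih =>
    refine Finset.sum_le_sum fun p hp => ih fun l hl hk => H _ ?_ (by simp [hk])
    simpa using ⟨hp, hl⟩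

theorem listSum_add (k : ℕ) (g h : List α → ℝ≥0∞) :
    (listSum S k fun l => g l + h l) = listSum S k g + listSum S k h := by
  induction k generalizing g h with
  | zero => rfl
  | succ k ih => simp only [listSum, ih, Finset.sum_add_distrib]

theorem listSum_zero (k : ℕ) : (listSum S k fun _ => 0) = 0 := by
  induction k with
  | zero => rfl
  | succ k ih => simp [listSum, ih]

theorem listSum_sum {ι : Type*} (T : Finset ι) (k : ℕ) (h : ι → List α → ℝ≥0∞) :
    (listSum S k fun l => ∑ i ∈ T, h i l) = ∑ i ∈ T, listSum S k (h i) := by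
  classical
  induction T using Finset.induction_on with
  | empty => simp [listSum_zero]
  | insert i T hi ih => simp only [Finset.sum_insert hi, listSum_add, ih]

theorem listSum_tsum {ι : Type*} (k : ℕ) (h : ι → List α → ℝ≥0∞) :
    (listSum S k fun l => ∑' i, h i l) = ∑' i, listSum S k (h i) := by
  induction k generalizing h with
  | zero => rfl
  | succ k ih =>
    simp only [listSum, ih]
    exact (Summable.tsum_finsetSum fun _ _ => ENNReal.summable).symm

theorem listSum_mul_left (k : ℕ) (m : ℝ≥0∞) (h : List α → ℝ≥0∞) :
    (listSum S k fun l => m * h l) = m * listSum S k h := by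
  induction k generalizing h with
  | zero => rfl
  | succ k ih => simp only [listSum, ih, Finset.mul_sum]

theorem listSum_one (k : ℕ) : (listSum S k fun _ => 1) = (S.card : ℝ≥0∞) ^ k := by
  induction k with
  | zero => simp [listSum]
  | succ k ih => simp [listSum, ih, pow_succ']

theorem listSum_not_mem [DecidableEq α] {p : α} (hp : p ∈ S) (k : ℕ) :
    (listSum S k fun l => if p ∈ l then 0 else 1) = ((S.card - 1 : ℕ) : ℝ≥0∞) ^ k := by
  induction k with
  | zero => simp [listSum]
  | succ k ih =>
    rw [listSum, ← Finset.add_sum_erase S _ hp]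
    have h1 : ∀ q ∈ S.erase p, (listSum S k fun l => if p ∈ q :: l then 0 else 1) =
        ((S.card - 1 : ℕ) : ℝ≥0∞) ^ k := by
      intro q hq
      rw [← ih]
      simp [(Finset.ne_of_mem_erase hq).symm]
    rw [Finset.sum_congr rfl h1]
    simp [listSum_zero, Finset.card_erase_of_mem hp, pow_succ']

end ListSum

/-! ## The sampling loop -/

section Loop

variable {w : ℕ} (A : Sampler)

/-- Mark a cell of an array. -/
def mark (M : BitVec w → BitVec w → BitVec w) (p : BitVec w × BitVec w) :
    BitVec w → BitVec w → BitVec w := updCell M p.1 p.2 (BitVec.ofNat w 1)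

theorem foldl_mark (M : BitVec w → BitVec w → BitVec w) (l : List (BitVec w × BitVec w))
    (x y : BitVec w) : l.foldl mark M x y = if (x, y) ∈ l then BitVec.ofNat w 1 else M x y := by
  induction l generalizing M with
  | nil => simp
  | cons p l ih =>
    rw [List.foldl_cons, ih, mark, updCell_apply]
    have : (x, y) = p ↔ x = p.1 ∧ y = p.2 := by rw [Prod.ext_iff]
    by_cases h1 : (x, y) ∈ l <;> by_cases h2 : x = p.1 ∧ y = p.2 <;> simp [h1, h2, this]

theorem cost_samplingLoop_zero (r : ℝ≥0∞) (f : State w → ℝ≥0∞) (c : Prog) {s : State w}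
    (h28 : s.reg 28 = BitVec.ofNat w 0) :
    cost (noOracle w) r f ([samplingLoop c], s) = r + f s := by
  rw [samplingLoop, cost_cons]
  simp [step, h28]

/-- Here `σ u` is the memory after one round in which the sampler leaves its own memory as `u`. Four
steps (test, two `seq`, decrement) precede the sampler and one store follows it. -/
theorem cost_samplingLoop_succ (r : ℝ≥0∞) (f : State w → ℝ≥0∞) {s : State w} {k : ℕ}
    (hk : k + 1 < 2 ^ w) (h28 : s.reg 28 = BitVec.ofNat w (k + 1))
    (h4 : s.reg 4 = BitVec.ofNat w 1) :
    ∃ σ : State w → State w, (∀ u, (σ u).sub = u ∧ (σ u).reg 28 = BitVec.ofNat w k ∧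
        (σ u).reg 4 = BitVec.ofNat w 1 ∧ (σ u).arr 4 = mark (s.arr 4) (u.reg 0, u.reg 1)) ∧
      cost (noOracle w) r f ([samplingLoop (A.sample.rename subName)], s) =
        r * 4 + (r * A.sample.expectedTime s.sub + ∑' u, A.sample.haltProb s.sub u *
          (r + cost (noOracle w) r f ([samplingLoop (A.sample.rename subName)], σ u))) := by
  set s1 := s.setReg 28 (BitVec.ofNat w k) with hs1
  refine ⟨fun u => (s1.withSub u).setArr 4 (u.reg 0) (u.reg 1) (BitVec.ofNat w 1),
    fun u => ⟨?_, ?_, ?_, ?_⟩, ?_⟩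
  · conv_rhs => rw [← s1.sub_withSub u]
    refine State.ext rfl (funext fun a => ?_)
    simp only [State.sub, State.arr_setArr]
    rw [if_neg (by omega)]
  · rw [State.reg_setArr, State.reg_withSub_even s1 u 14, hs1]
    simp
  · rw [State.reg_setArr, State.reg_withSub_even s1 u 2, hs1]
    simpa using h4
  · rw [State.arr_setArr, if_pos rfl, State.arr_withSub_even s1 u 2, hs1]
    rfl
  · have h0 : ¬ s.reg 28 = 0 := by
      change s.reg 28 ≠ 0#w
      rw [h28, Ne, ← BitVec.toNat_inj, BitVec.toNat_ofNat, Nat.mod_eq_of_lt hk]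
      simp
    have hsub : s.sub = s1.sub := (State.sub_setReg_even s 14 _).symm
    have e : (s.setReg 28 (BinOp.eval .sub (s.reg 28) (s.reg 4))) = s1 := by
      rw [h28, h4, BinOp.eval, ofNat_sub_one (by omega), Nat.add_sub_cancel]
    have hst : ∀ u, cost (noOracle w) r f ([.store 4 1 3 4,
        samplingLoop (A.sample.rename subName)], s1.withSub u) =
        r + cost (noOracle w) r f ([samplingLoop (A.sample.rename subName)],
          (s1.withSub u).setArr 4 (u.reg 0) (u.reg 1) (BitVec.ofNat w 1)) := by
      intro u
      rw [cost_cons]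
      simp only [step, expect_pure]
      rw [State.reg_withSub_odd s1 u 0, State.reg_withSub_odd s1 u 1,
        State.reg_withSub_even s1 u 2, hs1, State.reg_setReg, if_neg (by omega), h4]
    have hfold : ∀ c : Prog, Cmd.loop 28 (.seq (.op .sub 28 28 4) (.seq c (.store 4 1 3 4))) =
        samplingLoop c := fun _ => rfl
    conv_lhs => rw [samplingLoop, cost_cons]
    simp only [step, expect_pure, if_neg h0]
    rw [cost_cons]
    simp only [step, expect_pure]
    rw [cost_cons]
    simp only [step, expect_pure]
    rw [cost_cons]
    simp only [step, expect_pure]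
    rw [cost_rename_prog, e, hsub]
    simp only [hfold, hst]
    ring

/-- A lower bound for the expected value of `g` at the final product array. -/
theorem listSum_answersProb_le (S : Finset (BitVec w × BitVec w))
    (g : (BitVec w → BitVec w → BitVec w) → ℝ≥0∞) {k : ℕ} (hk : k < 2 ^ w) {s : State w}
    (h28 : s.reg 28 = BitVec.ofNat w k) (h4 : s.reg 4 = BitVec.ofNat w 1) :
    (listSum S k fun l => A.answersProb l s.sub * g (l.foldl mark (s.arr 4))) ≤
      cost (noOracle w) 0 (fun s => g (s.arr 4))
        ([samplingLoop (A.sample.rename subName)], s) := by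
  induction k generalizing s with
  | zero => simp [listSum, Sampler.answersProb, cost_samplingLoop_zero _ _ _ h28]
  | succ k ih =>
    obtain ⟨σ, hσ, e⟩ := cost_samplingLoop_succ A 0 (fun s => g (s.arr 4)) hk h28 h4
    rw [e]
    simp only [zero_mul, zero_add]
    simp only [listSum, Sampler.answersProb, ← ENNReal.tsum_mul_right, listSum_tsum, mul_assoc,
      listSum_mul_left]
    rw [← Summable.tsum_finsetSum fun _ _ => ENNReal.summable]
    refine ENNReal.tsum_le_tsum fun u => ?_
    rw [← Finset.mul_sum]
    gcongr
    obtain ⟨h1, h2, h3, h5⟩ := hσ u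
    refine le_trans ?_ (ih (by omega) h2 h3)
    rw [h1, h5]
    -- For a fixed outcome `u` at most one `p` matches the returned pair. Outcomes outside `S` are
    -- dropped, hence only an inequality.
    calc _ ≤ ∑ p ∈ S, if (u.reg 0, u.reg 1) = p then
          listSum S k (fun l => A.answersProb l u *
            g (List.foldl mark (mark (s.arr 4) (u.reg 0, u.reg 1)) l)) else 0 := by
          refine Finset.sum_le_sum fun p _ => ?_
          split_ifs with h
          · subst h; rfl
          · simp [listSum_zero]
      _ ≤ _ := by
          rw [Finset.sum_ite_eq]
          split_ifs <;> simp

/-- A bound on the expected time of the sampling loop. -/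
noncomputable def loopTime : ℕ → State w → ℝ≥0∞
  | 0, _ => 1
  | k + 1, u => 5 + A.sample.expectedTime u + ∑' u', A.sample.haltProb u u' * loopTime k u'

theorem cost_samplingLoop_le {k : ℕ} (hk : k < 2 ^ w) {s : State w}
    (h28 : s.reg 28 = BitVec.ofNat w k) (h4 : s.reg 4 = BitVec.ofNat w 1) :
    cost (noOracle w) 1 (fun _ => 0) ([samplingLoop (A.sample.rename subName)], s) ≤
      loopTime A k s.sub := by
  induction k generalizing s with
  | zero => simp [cost_samplingLoop_zero _ _ _ h28, loopTime]
  | succ k ih =>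
    obtain ⟨σ, hσ, e⟩ := cost_samplingLoop_succ A 1 (fun _ => 0) hk h28 h4
    rw [e]
    simp only [one_mul, mul_add, mul_one, ENNReal.tsum_add, loopTime]
    calc _ ≤ 4 + (A.sample.expectedTime s.sub + (1 + ∑' u, A.sample.haltProb s.sub u *
          loopTime A k u)) := by
          gcongr with u
          · exact haltProb_tsum_le_one _ _
          · obtain ⟨h1, h2, h3, -⟩ := hσ u
            simpa only [h1] using ih (by omega) h2 h3
      _ = _ := by
          rw [show (5 : ℝ≥0∞) = 4 + 1 by norm_num]
          ring

theorem memoryProb_tsum_le_one (s₀ : State w) (k : ℕ) : ∑' s, A.memoryProb s₀ k s ≤ 1 := by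
  induction k with
  | zero => exact haltProb_tsum_le_one _ _
  | succ k ih =>
    simp only [Sampler.memoryProb]
    rw [ENNReal.tsum_comm]
    simp only [ENNReal.tsum_mul_left]
    refine le_trans (ENNReal.tsum_le_tsum fun s => ?_) ih
    exact mul_le_of_le_one_right' (haltProb_tsum_le_one _ _)

/-- Unrolling one round moves the memory distribution from `j` to `j + 1` samples, and the time of
that round averages to `sampleTime I j`. Linearity of expectation suffices, so dependence between
successive running times is harmless; constants only shrink, as the total mass is at most one. -/
theorem tsum_memoryProb_mul_loopTime_le (I : Instance w) (k j : ℕ) :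
    ∑' s, A.memoryProb (samplerInput I) j s * loopTime A k s ≤
      1 + 5 * k + ∑ i ∈ Finset.range k, A.sampleTime I (j + i) := by
  induction k generalizing j with
  | zero => simpa [loopTime] using memoryProb_tsum_le_one A (samplerInput I) j
  | succ k ih =>
    have h : ∑' s, A.memoryProb (samplerInput I) j s *
        ∑' u', A.sample.haltProb s u' * loopTime A k u' =
        ∑' s, A.memoryProb (samplerInput I) (j + 1) s * loopTime A k s := by
      simp only [Sampler.memoryProb, ← ENNReal.tsum_mul_left, ← ENNReal.tsum_mul_right]
      rw [ENNReal.tsum_comm]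
      simp only [mul_assoc]
    simp only [loopTime, mul_add, ENNReal.tsum_add, h]
    rw [Finset.sum_range_succ', ENNReal.tsum_mul_right]
    calc _ ≤ 1 * 5 + A.sampleTime I j +
          (1 + 5 * k + ∑ i ∈ Finset.range k, A.sampleTime I (j + 1 + i)) := by
          gcongr
          · exact memoryProb_tsum_le_one A _ _
          · rfl
          · exact ih (j + 1)
      _ = _ := by
          simp only [add_zero, Nat.cast_add, Nat.cast_one, add_assoc, add_comm 1]
          ring

end Loop

/-! ## The result of the query on the constructed instance -/

section FinalInstance

variable {w n : ℕ} {A B : Fin n → Fin n → Bool}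

/-- The instance on which the sampling algorithm is run. -/
noncomputable abbrev paddedInstance (w : ℕ) (A B : Fin n → Fin n → Bool) : Instance w :=
  initialInstance w A B ((2 * n + 2) * (2 * n + 2))

theorem mem_initialRel_all {P : ℕ} {p : ℕ → ℕ → Prop} {q : BitVec w × BitVec w} :
    q ∈ initialRel w P p (P * P) ↔ q.1.toNat < P ∧ q.2.toNat < P ∧ p q.1.toNat q.2.toNat := by
  rw [mem_initialRel]
  constructor
  · rintro ⟨h1, h2, h3⟩
    exact ⟨Nat.lt_of_mul_lt_mul_right (lt_of_le_of_lt (Nat.le_add_right _ _) h2), h1, h3⟩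
  · rintro ⟨h1, h2, h3⟩
    refine ⟨h2, ?_, h3⟩
    calc q.1.toNat * P + q.2.toNat < q.1.toNat * P + P := by omega
      _ = (q.1.toNat + 1) * P := by ring
      _ ≤ P * P := Nat.mul_le_mul_right _ h1

theorem Instance.mem_result {I : Instance w} {p : BitVec w × BitVec w} :
    p ∈ I.result ↔ ∃ b, (p.1, b) ∈ I.R₁ ∧ (b, p.2) ∈ I.R₂ := by
  simp only [Instance.result, Finset.mem_image, Finset.mem_filter, Finset.mem_product]
  constructor
  · rintro ⟨⟨⟨a, b⟩, ⟨b', c⟩⟩, ⟨⟨h1, h2⟩, h3⟩, rfl⟩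
    obtain rfl : b = b' := h3
    exact ⟨b, h1, h2⟩
  · rintro ⟨b, h1, h2⟩
    exact ⟨((p.1, b), (b, p.2)), ⟨⟨h1, h2⟩, rfl⟩, rfl⟩

variable (hN : (2 * n + 2) * (2 * n + 2) < 2 ^ w)

theorem size_paddedInstance_le : (paddedInstance w A B).size ≤ 2 * (2 * n + 2) ^ 2 := by
  have h1 := card_initialRel_le (w := w) (P := 2 * n + 2) (p := LeftTuple A)
    (k := (2 * n + 2) * (2 * n + 2))
  have h2 := card_initialRel_le (w := w) (P := 2 * n + 2) (p := RightTuple B)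
    (k := (2 * n + 2) * (2 * n + 2))
  calc _ ≤ (2 * n + 2) * (2 * n + 2) + (2 * n + 2) * (2 * n + 2) := add_le_add h1 h2
    _ = _ := by ring

theorem out_paddedInstance_le : (paddedInstance w A B).out ≤ (2 * n + 2) ^ 2 := by
  have h : (paddedInstance w A B).out ≤
      (Finset.range (2 * n + 2) ×ˢ Finset.range (2 * n + 2)).card := by
    refine Finset.card_le_card_of_injOn (fun p => (p.1.toNat, p.2.toNat)) ?_ ?_
    · intro p hp
      obtain ⟨b, h1, h2⟩ := Instance.mem_result.1 hp
      have h3 := (mem_initialRel_all.1 h1).1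
      have h4 := (mem_initialRel_all.1 h2).2.1
      simpa using ⟨h3, h4⟩
    · rintro p - q - h
      simp only [Prod.mk.injEq, BitVec.toNat_inj] at h
      exact Prod.ext h.1 h.2
  simpa [sq] using h

include hN

/-- The `n + 1` padding values `n + 1, …, 2n + 1` on either side are all joined through the middle
value `n`. -/
theorem le_out_paddedInstance : (n + 1) ^ 2 ≤ (paddedInstance w A B).out := by
  have hP : 2 * n + 2 < 2 ^ w := lt_of_le_of_lt (Nat.le_mul_of_pos_left _ (by omega)) hN
  have hmod : ∀ x, x < n + 1 → (BitVec.ofNat w (n + 1 + x)).toNat = n + 1 + x := fun x hx => by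
    rw [BitVec.toNat_ofNat, Nat.mod_eq_of_lt (by omega)]
  have hmodn : (BitVec.ofNat w n).toNat = n := by
    rw [BitVec.toNat_ofNat, Nat.mod_eq_of_lt (by omega)]
  have h : (Finset.range (n + 1) ×ˢ Finset.range (n + 1)).card ≤ (paddedInstance w A B).out := by
    refine Finset.card_le_card_of_injOn
      (fun p => (BitVec.ofNat w (n + 1 + p.1), BitVec.ofNat w (n + 1 + p.2))) ?_ ?_
    · rintro ⟨x, y⟩ hp
      simp only [Finset.coe_product, Finset.coe_range, Set.mem_prod, Set.mem_Iio] at hp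
      refine Instance.mem_result.2 ⟨BitVec.ofNat w n, mem_initialRel_all.2 ?_,
        mem_initialRel_all.2 ?_⟩
      · simp only [hmod x hp.1, hmodn]
        exact ⟨by omega, by omega, Or.inr ⟨rfl, by omega⟩⟩
      · simp only [hmod y hp.2, hmodn]
        exact ⟨by omega, by omega, Or.inr ⟨rfl, by omega⟩⟩
    · rintro ⟨x, y⟩ hp ⟨x', y'⟩ hp' h
      simp only [Finset.coe_product, Finset.coe_range, Set.mem_prod, Set.mem_Iio] at hp hp'
      simp only [Prod.mk.injEq] at h
      rw [ofNat_eq_iff (by omega) (by omega), ofNat_eq_iff (by omega) (by omega)] at h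
      simp only [Prod.mk.injEq]
      omega
  simpa [sq] using h

/-- A padding tuple has an outer value above `n`, so it cannot witness a pair of matrix indices. -/
theorem mem_result_paddedInstance (i k : Fin n) :
    (BitVec.ofNat w i.val, BitVec.ofNat w k.val) ∈ (paddedInstance w A B).result ↔
      boolMul A B i k = true := by
  have hP : 2 * n + 2 < 2 ^ w := lt_of_le_of_lt (Nat.le_mul_of_pos_left _ (by omega)) hN
  have hmod : ∀ x, x < n → (BitVec.ofNat w x).toNat = x := fun x hx => by
    rw [BitVec.toNat_ofNat, Nat.mod_eq_of_lt (by omega)]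
  have hi := i.isLt
  have hk := k.isLt
  rw [Instance.mem_result, boolMul, decide_eq_true_iff]
  constructor
  · rintro ⟨b, h1, h2⟩
    obtain ⟨-, -, h1⟩ := mem_initialRel_all.1 h1
    obtain ⟨-, -, h2⟩ := mem_initialRel_all.1 h2
    simp only [hmod _ hi, hmod _ hk] at h1 h2
    rcases h1 with ⟨_, hb, h1⟩ | ⟨-, h1⟩
    · rcases h2 with ⟨_, _, h2⟩ | ⟨-, h2⟩
      · exact ⟨⟨b.toNat, hb⟩, h1, h2⟩
      · omega
    · omega
  · rintro ⟨j, h1, h2⟩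
    have hj := j.isLt
    refine ⟨BitVec.ofNat w j.val, mem_initialRel_all.2 ?_, mem_initialRel_all.2 ?_⟩
    · simp only [hmod _ hi, hmod _ hj]
      exact ⟨by omega, by omega, Or.inl ⟨hi, hj, h1⟩⟩
    · simp only [hmod _ hj, hmod _ hk]
      exact ⟨by omega, by omega, Or.inl ⟨hj, hk, h2⟩⟩

end FinalInstance

/-! ## Success probability -/

/-- The coupon collector estimate. With `L` the binary length of `2n + 2`, the left side is `M (1 -
1/M) ^ K ≤ M exp (-K/M)`. Since `K ≥ 4 L M` and `M ≤ 2 ^ (2L)`, it is at most `2 ^ (2L) · 2 ^ (-4L)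
≤ 2 ^ (-4)`, using `L ≥ 2`. -/
theorem mul_one_sub_inv_pow_le {n M : ℕ} (hM : 1 ≤ M) (hM' : M ≤ (2 * n + 2) ^ 2) :
    (M : ℝ≥0∞) * (((M - 1 : ℕ) : ℝ≥0∞) ^ numSamples n * ((M : ℝ≥0∞)⁻¹) ^ numSamples n) ≤
      ENNReal.ofReal (1 / 16) := by
  set K := numSamples n with hK
  set L := Nat.size (2 * n + 2) with hL
  have hM0 : (0 : ℝ) < M := by exact_mod_cast hM
  have hconv : (M : ℝ≥0∞) * (((M - 1 : ℕ) : ℝ≥0∞) ^ K * ((M : ℝ≥0∞)⁻¹) ^ K) =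
      ENNReal.ofReal (M * (((M : ℝ) - 1) / M) ^ K) := by
    have h1 : (0 : ℝ) ≤ ((M - 1 : ℕ) : ℝ) := Nat.cast_nonneg _
    have e : (M : ℝ) - 1 = ((M - 1 : ℕ) : ℝ) := by rw [Nat.cast_sub hM, Nat.cast_one]
    rw [e, div_eq_mul_inv, mul_pow,
      ENNReal.ofReal_mul hM0.le, ENNReal.ofReal_mul (by positivity), ENNReal.ofReal_pow h1,
      ENNReal.ofReal_pow (by positivity), ENNReal.ofReal_inv_of_pos hM0]
    simp only [ENNReal.ofReal_natCast]
  rw [hconv]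
  refine ENNReal.ofReal_le_ofReal ?_
  have hbase : ((M : ℝ) - 1) / M ≤ Real.exp (-(1 / M)) := by
    have := Real.add_one_le_exp (-(1 / (M : ℝ)))
    calc ((M : ℝ) - 1) / M = -(1 / M) + 1 := by field_simp; ring
      _ ≤ _ := this
  have hbase0 : 0 ≤ ((M : ℝ) - 1) / M := by
    have : (1 : ℝ) ≤ M := by exact_mod_cast hM
    exact div_nonneg (by linarith) hM0.le
  have hKM : (4 * L : ℝ) ≤ K / M := by
    rw [le_div_iff₀ hM0]
    have : 4 * L * M ≤ K := by
      calc 4 * L * M ≤ 4 * L * (2 * n + 2) ^ 2 := Nat.mul_le_mul_left _ hM'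
        _ = K := by rw [hK, numSamples]; ring
    exact_mod_cast this
  have hpow : (((M : ℝ) - 1) / M) ^ K ≤ (1 / 2) ^ (4 * L) := by
    calc (((M : ℝ) - 1) / M) ^ K ≤ Real.exp (-(1 / M)) ^ K := by gcongr
      _ = Real.exp (-(K / M)) := by rw [← Real.exp_nat_mul]; congr 1; ring
      _ ≤ Real.exp (-(4 * L)) := by gcongr
      _ = Real.exp (-1) ^ (4 * L) := by rw [← Real.exp_nat_mul]; push_cast; congr 1; ring
      _ ≤ (1 / 2) ^ (4 * L) := by
          gcongr
          rw [Real.exp_neg, ← one_div]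
          gcongr
          have := Real.add_one_le_exp (1 : ℝ)
          linarith
  have hML : (M : ℝ) ≤ 2 ^ (2 * L) := by
    have h1 : 2 * n + 2 < 2 ^ L := Nat.lt_size_self _
    have h2 : M ≤ 2 ^ (2 * L) := by
      refine hM'.trans ?_
      calc (2 * n + 2) ^ 2 ≤ (2 ^ L) ^ 2 := Nat.pow_le_pow_left h1.le _
        _ = 2 ^ (2 * L) := by rw [← pow_mul, mul_comm]
    exact_mod_cast h2
  have hL2 : 2 ≤ L := Nat.lt_size.2 (by omega)
  calc (M : ℝ) * (((M : ℝ) - 1) / M) ^ K ≤ 2 ^ (2 * L) * (1 / 2) ^ (4 * L) := by gcongr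
    _ = (1 / 2) ^ (2 * L) := by
        rw [show 4 * L = 2 * L + 2 * L by ring, pow_add, ← mul_assoc, ← mul_pow]
        norm_num
    _ ≤ (1 / 2) ^ 4 := pow_le_pow_of_le_one (by norm_num) (by norm_num) (by omega)
    _ = 1 / 16 := by norm_num

section Success

variable {w n : ℕ} {A B : Fin n → Fin n → Bool} {S : Sampler}

/-- If all elements of the query result have been sampled, then the marked cells are the product. -/
theorem holdsProduct_of_marked (hN : (2 * n + 2) * (2 * n + 2) < 2 ^ w)
    {l : List (BitVec w × BitVec w)} (hl : ∀ p ∈ l, p ∈ (paddedInstance w A B).result)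
    (hl' : ∀ p ∈ (paddedInstance w A B).result, p ∈ l) (i k : Fin n) :
    l.foldl mark (fun _ _ => BitVec.ofNat w 0) (BitVec.ofNat w i.val) (BitVec.ofNat w k.val) =
      bit w (boolMul A B i k) := by
  rw [foldl_mark, bit]
  have h : (BitVec.ofNat w i.val, BitVec.ofNat w k.val) ∈ l ↔ boolMul A B i k = true := by
    rw [← mem_result_paddedInstance hN]
    exact ⟨hl _, hl' _⟩
  simp only [h]

/-- Every list of `K` results is drawn with probability `OUT ^ (-K)`. Lists that cover the result
produce the product, and a union bound over the missed element controls the remaining ones. -/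
theorem success_probability (hN : (2 * n + 2) * (2 * n + 2) < 2 ^ w) (hK : numSamples n < 2 ^ w)
    (hS : S.IsUniformOn (paddedInstance w A B)) :
    1 ≤ cost (noOracle w) 0 ({s' | HoldsProduct A B s'}.indicator fun _ => 1)
      ([samplingReduction.applyTo S], bmmInput w A B) + ENNReal.ofReal (1 / 16) := by
  classical
  set I := paddedInstance w A B with hI
  set K := numSamples n with hKdef
  have hout : 1 ≤ I.out := le_trans (Nat.one_le_pow _ _ (by omega)) (le_out_paddedInstance hN)
  set g : (BitVec w → BitVec w → BitVec w) → ℝ≥0∞ := fun M =>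
    if ∀ i k : Fin n, M (BitVec.ofNat w i.val) (BitVec.ofNat w k.val) = bit w (boolMul A B i k)
    then 1 else 0 with hg
  have hgood : ({s' | HoldsProduct A B s'}.indicator fun _ => 1 : State w → ℝ≥0∞) =
      fun s => g (s.arr 4) := by
    ext s
    simp [Set.indicator_apply, hg, HoldsProduct]
  have hcost : (listSum I.result K fun l => (I.out : ℝ≥0∞)⁻¹ ^ K *
      g (l.foldl mark fun _ _ => BitVec.ofNat w 0)) ≤
      cost (noOracle w) 0 (fun s => g (s.arr 4))
        ([samplingReduction.applyTo S], bmmInput w A B) := by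
    rw [applyTo_samplingReduction, cost_cons]
    simp only [step, expect_pure, zero_add]
    refine (reaches_setup (noOracle w) A B hN _).le_cost ?_
    rintro _ ⟨s, rfl, hs⟩
    rw [cost_cons]
    simp only [step, expect_pure, zero_add]
    rw [cost_rename_prog, zero_mul, zero_add, hs.sub]
    have h1 : ∀ u, (listSum I.result K fun l => S.answersProb l u *
        g (l.foldl mark fun _ _ => BitVec.ofNat w 0)) ≤
        cost (noOracle w) 0 (fun s => g (s.arr 4))
          ([samplingLoop (S.sample.rename subName)], s.withSub u) := by
      intro u
      have h2 := listSum_answersProb_le S I.result g hK (s := s.withSub u)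
        ((State.reg_withSub_even s u 14).trans hs.regK)
        ((State.reg_withSub_even s u 2).trans hs.regOne)
      rwa [State.sub_withSub, State.arr_withSub_even s u 2, hs.arrOut] at h2
    refine le_trans ?_ (ENNReal.tsum_le_tsum fun u => mul_le_mul_right (h1 u) _)
    simp only [← listSum_mul_left, ← listSum_tsum]
    refine listSum_mono fun l hl hlen => ?_
    -- Uniformity and independence enter only here, as the exact probability of a whole list.
    rw [← hlen, ← hS l hl, ← ENNReal.tsum_mul_right]
    simp only [mul_assoc]
    rfl
  have hone : (I.out : ℝ≥0∞)⁻¹ ^ K * (I.out : ℝ≥0∞) ^ K = 1 := by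
    rw [← mul_pow, ENNReal.inv_mul_cancel (by positivity) (by simp), one_pow]
  have hsplit : (1 : ℝ≥0∞) ≤ (listSum I.result K fun l => (I.out : ℝ≥0∞)⁻¹ ^ K *
      g (l.foldl mark fun _ _ => BitVec.ofNat w 0)) +
      (I.out : ℝ≥0∞) * (((I.out - 1 : ℕ) : ℝ≥0∞) ^ K * ((I.out : ℝ≥0∞)⁻¹) ^ K) := by
    calc (1 : ℝ≥0∞) = listSum I.result K fun _ => (I.out : ℝ≥0∞)⁻¹ ^ K * 1 := by
          rw [listSum_mul_left, listSum_one]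
          exact hone.symm
      _ ≤ listSum I.result K fun l => (I.out : ℝ≥0∞)⁻¹ ^ K *
            g (l.foldl mark fun _ _ => BitVec.ofNat w 0) +
          ∑ p ∈ I.result, (I.out : ℝ≥0∞)⁻¹ ^ K * if p ∈ l then 0 else 1 := by
          refine listSum_mono fun l hl _ => ?_
          rw [← Finset.mul_sum, ← mul_add]
          gcongr
          -- Pointwise form of the union bound: either the list covers the result and `g` is `1`, or
          -- some missed `p` contributes `1` to the sum.
          by_cases h : ∀ p ∈ I.result, p ∈ l
          · refine le_trans (le_of_eq ?_) le_self_add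
            rw [hg]
            exact (if_pos (holdsProduct_of_marked hN hl h)).symm
          · push Not at h
            obtain ⟨p, hp, hpl⟩ := h
            refine le_trans ?_ le_add_self
            calc (1 : ℝ≥0∞) = if p ∈ l then 0 else 1 := by simp [hpl]
              _ ≤ _ := Finset.single_le_sum (f := fun p => if p ∈ l then (0 : ℝ≥0∞) else 1)
                  (fun _ _ => zero_le) hp
      _ = _ := by
          rw [listSum_add, listSum_sum]
          congr 1
          have h1 : ∀ p ∈ I.result, (listSum I.result K fun l =>
              (I.out : ℝ≥0∞)⁻¹ ^ K * if p ∈ l then 0 else 1) =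
              ((I.out - 1 : ℕ) : ℝ≥0∞) ^ K * ((I.out : ℝ≥0∞)⁻¹) ^ K := by
            intro p hp
            have h2 := listSum_not_mem hp K
            rw [listSum_mul_left, mul_comm]
            congr 1
            convert h2
            rfl
          rw [Finset.sum_congr rfl h1, Finset.sum_const, nsmul_eq_mul]
          rfl
  rw [hgood]
  exact hsplit.trans (add_le_add hcost (mul_one_sub_inv_pow_le hout out_paddedInstance_le))

/-! ## Running time -/

/-- The constant `3` counts the two `seq` around the setup and the preprocessing, and the last test
of the sampling loop. -/
theorem expected_time_le (hN : (2 * n + 2) * (2 * n + 2) < 2 ^ w) (hK : numSamples n < 2 ^ w) :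
    cost (noOracle w) 1 (fun _ => 0) ([samplingReduction.applyTo S], bmmInput w A B) ≤
      (setupSteps n + 3 + 5 * numSamples n : ℕ) +
        (S.pre.expectedTime (samplerInput (paddedInstance w A B)) +
          ∑ i ∈ Finset.range (numSamples n), S.sampleTime (paddedInstance w A B) i) := by
  rw [applyTo_samplingReduction, cost_cons]
  simp only [step, expect_pure]
  have h : ∀ c : Config Empty w, (∃ s, c = ([.seq (S.pre.rename subName)
      (samplingLoop (S.sample.rename subName))], s) ∧ SetupDone A B s) →
      cost (noOracle w) 1 (fun _ => 0) c ≤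
      1 + (S.pre.expectedTime (samplerInput (paddedInstance w A B)) + (1 + 5 * numSamples n +
        ∑ i ∈ Finset.range (numSamples n), S.sampleTime (paddedInstance w A B) i)) := by
    rintro _ ⟨s, rfl, hs⟩
    rw [cost_cons]
    simp only [step, expect_pure]
    rw [cost_rename_prog, one_mul, hs.sub]
    gcongr
    refine le_trans (ENNReal.tsum_le_tsum fun u => ?_)
      ((tsum_memoryProb_mul_loopTime_le S (paddedInstance w A B) (numSamples n) 0).trans ?_)
    · rw [Sampler.memoryProb]
      gcongr
      have h2 := cost_samplingLoop_le S hK (s := s.withSub u)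
        ((State.reg_withSub_even s u 14).trans hs.regK)
        ((State.reg_withSub_even s u 2).trans hs.regOne)
      rwa [State.sub_withSub] at h2
    · simp
  calc _ ≤ 1 + (1 * (setupSteps n : ℝ≥0∞) + _) :=
        add_le_add le_rfl ((reaches_setup (noOracle w) A B hN _).cost_le h)
    _ = _ := by
        push_cast
        rw [show (3 : ℝ≥0∞) = 1 + 1 + 1 by norm_num]
        ring

end Success

/-- With `X = n + 1`, `2 ^ (L - 2) ≤ X` gives `(L - 2) log 2 ≤ log X ≤ X ^ ε / ε`, and `log 2 >
1/2`. The additive `2` is absorbed by `X ^ ε ≥ 1`. -/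
theorem size_le_rpow (n : ℕ) {ε : ℝ} (hε : 0 < ε) :
    (Nat.size (2 * n + 2) : ℝ) ≤ (2 + 2 / ε) * ((n : ℝ) + 1) ^ ε := by
  set L := Nat.size (2 * n + 2)
  set X : ℝ := (n : ℝ) + 1
  have hX : 1 ≤ X := by simp [X]
  have hL2 : 2 ≤ L := Nat.lt_size.2 (by omega)
  have h1 : 2 ^ (L - 1) ≤ 2 * n + 2 := Nat.lt_size.1 (by omega)
  have h2 : 2 ^ (L - 2) ≤ n + 1 := by
    rw [show L - 1 = L - 2 + 1 by omega, pow_succ] at h1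
    omega
  have h3 : (2 : ℝ) ^ (L - 2) ≤ X := by
    have : ((2 ^ (L - 2) : ℕ) : ℝ) ≤ ((n + 1 : ℕ) : ℝ) := Nat.cast_le.2 h2
    push_cast at this
    exact this
  have h4 : ((L - 2 : ℕ) : ℝ) * Real.log 2 ≤ Real.log X := by
    rw [← Real.log_pow]
    exact Real.log_le_log (by positivity) h3
  have h5 : Real.log X ≤ X ^ ε / ε := Real.log_le_rpow_div (by linarith) hε
  have h6 : 1 / 2 < Real.log 2 := by linarith [Real.log_two_gt_d9]
  have h7 : ((L - 2 : ℕ) : ℝ) = L - 2 := by rw [Nat.cast_sub hL2]; norm_num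
  have h8 : (1 : ℝ) ≤ X ^ ε := Real.one_le_rpow hX hε.le
  have h9 : (0 : ℝ) ≤ ((L - 2 : ℕ) : ℝ) := Nat.cast_nonneg _
  have h10 : (L : ℝ) - 2 ≤ 2 * (X ^ ε / ε) := by
    rw [← h7]
    nlinarith
  calc (L : ℝ) ≤ 2 * 1 + 2 * (X ^ ε / ε) := by linarith
    _ ≤ 2 * X ^ ε + 2 * (X ^ ε / ε) := by gcongr
    _ = _ := by ring

/-- The number of samples is `O(X ^ (2 + ε))`, the logarithm being swallowed by `X ^ ε`, and each
sample costs `O(X ^ (1 - 2ε))`. The exponents add up to `3 - ε`. -/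
theorem time_bound {γ : ℝ} (hγ : 0 < γ) {C : ℝ} (hC : 0 ≤ C) :
    ∃ C' ε : ℝ, 0 < ε ∧ ε ≤ 1 / 4 ∧ 1 ≤ C' ∧ ∀ n N M : ℕ, N ≤ 2 * (2 * n + 2) ^ 2 → (n + 1) ^ 2 ≤ M →
      M ≤ (2 * n + 2) ^ 2 →
      (setupSteps n + 3 + 5 * numSamples n : ℕ) + (C * max 1 ((N : ℝ) * (M : ℝ) ^ (1 / 2 - γ)) +
        numSamples n * (C * max 1 ((N : ℝ) / (M : ℝ) ^ (1 / 2 + γ)))) ≤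
      C' * ((n : ℝ) + 1) ^ (3 - ε) := by
  -- Capping by `1/4` keeps `1/2 - ε` and `1 - 2ε` nonnegative and gives `2 + ε ≤ 3 - ε`. Replacing
  -- `γ` by `ε` only weakens the bounds, since `M ≥ 1`.
  set ε := min γ (1 / 4) with hε
  have hε0 : 0 < ε := lt_min hγ (by norm_num)
  have hεγ : ε ≤ γ := min_le_left _ _
  have hε4 : ε ≤ 1 / 4 := min_le_right _ _
  set c := 2 + 2 / ε with hc
  have hc0 : 0 < c := by positivity
  -- `410 = 360 + 12 + 35 + 3` from the setup, `80 c = 5 · 16 c` from loop overhead, `32 = 8 · 4`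
  -- from preprocessing, `128 c = 16 c · 8` from the samples.
  refine ⟨410 + 80 * c + 32 * C + 128 * c * C, ε, hε0, hε4, by nlinarith [mul_nonneg hc0.le hC], ?_⟩
  intro n N M hN hM hM'
  set X : ℝ := (n : ℝ) + 1 with hXdef
  have hX : 1 ≤ X := by simp [X]
  have hX0 : 0 < X := by linarith
  have hsize := size_le_rpow n hε0
  have hsize' : (Nat.size (2 * n + 2) : ℝ) ≤ 2 * X := by
    have : Nat.size (2 * n + 2) ≤ 2 * n + 2 := size_le_self _
    have : (Nat.size (2 * n + 2) : ℝ) ≤ 2 * n + 2 := by exact_mod_cast this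
    linarith
  have hNX : (N : ℝ) ≤ 8 * X ^ 2 := by
    have : (N : ℝ) ≤ 2 * (2 * n + 2) ^ 2 := by exact_mod_cast hN
    calc (N : ℝ) ≤ 2 * (2 * n + 2) ^ 2 := this
      _ = 8 * X ^ 2 := by rw [hXdef]; ring
  have hMX : X ^ 2 ≤ M := by rw [hXdef]; exact_mod_cast hM
  have hMX' : (M : ℝ) ≤ 4 * X ^ 2 := by
    have : (M : ℝ) ≤ (2 * n + 2) ^ 2 := by exact_mod_cast hM'
    calc (M : ℝ) ≤ (2 * n + 2) ^ 2 := this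
      _ = 4 * X ^ 2 := by rw [hXdef]; ring
  have hM1 : (1 : ℝ) ≤ M := le_trans (one_le_pow₀ hX) hMX
  have hXX : X ^ 2 = X ^ (2 : ℝ) := (Real.rpow_two X).symm
  have hle : ∀ {a b : ℝ}, a ≤ b → X ^ a ≤ X ^ b := fun h => Real.rpow_le_rpow_of_exponent_le hX h
  have hX2 : X ^ 2 ≤ X ^ (3 - ε) := by rw [hXX]; exact hle (by linarith)
  have hX1 : X ≤ X ^ 2 := by nlinarith
  have hone : 1 ≤ X ^ (3 - ε) := Real.one_le_rpow hX (by linarith)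
  have hK : (numSamples n : ℝ) ≤ 16 * c * X ^ (2 + ε) := by
    calc (numSamples n : ℝ) = 16 * X ^ 2 * Nat.size (2 * n + 2) := by
          rw [numSamples, hXdef]; push_cast; ring
      _ ≤ 16 * X ^ 2 * (c * X ^ ε) := by gcongr
      _ = 16 * c * X ^ (2 + ε) := by rw [Real.rpow_add hX0, hXX]; ring
  have h1 : ((setupSteps n + 3 + 5 * numSamples n : ℕ) : ℝ) ≤ (410 + 80 * c) * X ^ (3 - ε) := by
    have e1 : ((setupSteps n : ℕ) : ℝ) = 360 * X ^ 2 + Nat.size (2 * n + 2) * 6 + 35 := by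
      rw [setupSteps, hXdef]; push_cast; ring
    have e2 : X ^ (2 + ε) ≤ X ^ (3 - ε) := hle (by linarith)
    have e3 : (numSamples n : ℝ) ≤ 16 * c * X ^ (3 - ε) := hK.trans (by gcongr)
    have e4 : (setupSteps n : ℝ) + 3 ≤ 410 * X ^ (3 - ε) := by
      rw [e1]; linarith
    push_cast
    linarith
  have h2 : max 1 ((N : ℝ) * (M : ℝ) ^ (1 / 2 - γ)) ≤ 32 * X ^ (3 - ε) := by
    refine max_le (by linarith) ?_
    calc (N : ℝ) * (M : ℝ) ^ (1 / 2 - γ) ≤ 8 * X ^ 2 * (M : ℝ) ^ (1 / 2 - ε) := by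
          gcongr
      _ ≤ 8 * X ^ 2 * (4 * X ^ 2) ^ (1 / 2 - ε) := by
          gcongr
          linarith
      _ = 8 * X ^ 2 * (4 ^ (1 / 2 - ε) * X ^ (1 - 2 * ε)) := by
          rw [Real.mul_rpow (by norm_num) (by positivity), hXX, ← Real.rpow_mul hX0.le]
          ring_nf
      _ ≤ 8 * X ^ 2 * (4 ^ (1 : ℝ) * X ^ (1 - 2 * ε)) := by
          gcongr
          · norm_num
          · linarith
      _ = 32 * X ^ (3 - 2 * ε) := by
          rw [show 3 - 2 * ε = 2 + (1 - 2 * ε) by ring, Real.rpow_add hX0, hXX, Real.rpow_one]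
          ring
      _ ≤ 32 * X ^ (3 - ε) := by
          gcongr
          linarith
  have h3 : max 1 ((N : ℝ) / (M : ℝ) ^ (1 / 2 + γ)) ≤ 8 * X ^ (1 - 2 * ε) := by
    refine max_le ?_ ?_
    · have := Real.one_le_rpow hX (show 0 ≤ 1 - 2 * ε by linarith)
      linarith
    · rw [div_le_iff₀ (by positivity)]
      have e1 : X ^ (1 + 2 * ε) ≤ (M : ℝ) ^ (1 / 2 + γ) := by
        calc X ^ (1 + 2 * ε) = (X ^ 2) ^ (1 / 2 + ε) := by
              rw [hXX, ← Real.rpow_mul hX0.le]; ring_nf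
          _ ≤ (M : ℝ) ^ (1 / 2 + ε) := by gcongr
          _ ≤ (M : ℝ) ^ (1 / 2 + γ) := Real.rpow_le_rpow_of_exponent_le hM1 (by linarith)
      calc (N : ℝ) ≤ 8 * X ^ 2 := hNX
        _ = 8 * X ^ (1 - 2 * ε) * X ^ (1 + 2 * ε) := by
            rw [mul_assoc, ← Real.rpow_add hX0, hXX]; ring_nf
        _ ≤ _ := by gcongr
  calc _ ≤ (410 + 80 * c) * X ^ (3 - ε) + (C * (32 * X ^ (3 - ε)) +
        16 * c * X ^ (2 + ε) * (C * (8 * X ^ (1 - 2 * ε)))) := by gcongr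
    _ = (410 + 80 * c) * X ^ (3 - ε) + (C * (32 * X ^ (3 - ε)) +
        128 * c * C * X ^ (3 - ε)) := by
        rw [show 3 - ε = (2 + ε) + (1 - 2 * ε) by ring, Real.rpow_add hX0]
        ring
    _ = _ := by ring

/-! ## The multiplication algorithm -/

theorem multipliesInTime_of_samplesInTime {S : Sampler} {γ : ℝ} (hγ : 0 < γ)
    (hS : S.SamplesInTime γ) :
    ∃ ε > 0, MultipliesInTime (samplingReduction.applyTo S) (3 - ε) := by
  obtain ⟨κ, C, hS⟩ := hS
  obtain ⟨C', ε, hε, hε4, hC', hbound⟩ := time_bound hγ (abs_nonneg C)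
  -- `5 * κ` comes from `I.size + 2 ≤ (n + 2) ^ 5`, and `8` prevents overflow in the construction.
  -- The factor `6` yields failure probability `1/6` in Markov's inequality; the extra `1`
  -- compensates for the floor.
  refine ⟨ε, hε, 5 * κ + 8, 6 * C' + 1, fun w n A B hw => ?_⟩
  have hw8 : (n + 2) ^ 8 ≤ 2 ^ w := le_trans (Nat.pow_le_pow_right (by omega) (by omega)) hw
  have hN := pairs_lt hw8
  have hK := numSamples_lt hw8
  set I := paddedInstance w A B with hI
  have hsize : I.size ≤ 2 * (2 * n + 2) ^ 2 := size_paddedInstance_le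
  have hout : (n + 1) ^ 2 ≤ I.out := le_out_paddedInstance hN
  have hκ : (I.size + 2) ^ κ ≤ 2 ^ w := by
    refine le_trans ?_ hw
    calc (I.size + 2) ^ κ ≤ ((n + 2) ^ 5) ^ κ := by
          refine Nat.pow_le_pow_left ?_ _
          calc I.size + 2 ≤ 2 * (2 * n + 2) ^ 2 + 2 := by omega
            _ ≤ 2 ^ 3 * (n + 2) ^ 2 := by nlinarith
            _ ≤ (n + 2) ^ 3 * (n + 2) ^ 2 := by gcongr; omega
            _ = (n + 2) ^ 5 := by ring
      _ = (n + 2) ^ (5 * κ) := by rw [← pow_mul]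
      _ ≤ (n + 2) ^ (5 * κ + 8) := Nat.pow_le_pow_right (by omega) (by omega)
  obtain ⟨huni, hpre, hsample⟩ := hS w I hκ (le_trans (Nat.one_le_pow _ _ (by omega)) hout)
  set Y : ℝ := ((n : ℝ) + 1) ^ (3 - ε) with hY
  have hE : cost (noOracle w) 1 (fun _ => 0) ([samplingReduction.applyTo S], bmmInput w A B) ≤
      ENNReal.ofReal (C' * Y) := by
    -- The constant of the sampler is not assumed nonnegative, while `time_bound` needs that.
    have habs : ∀ x : ℝ, ENNReal.ofReal (C * max 1 x) ≤ ENNReal.ofReal (|C| * max 1 x) :=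
      fun x => ENNReal.ofReal_le_ofReal (by gcongr; exact le_abs_self C)
    have hpos : ∀ x : ℝ, 0 ≤ |C| * max 1 x := fun x =>
      mul_nonneg (abs_nonneg C) (le_trans zero_le_one (le_max_left _ _))
    refine (expected_time_le hN hK).trans ?_
    refine le_trans ?_ (ENNReal.ofReal_le_ofReal
      (hbound n I.size I.out hsize hout out_paddedInstance_le))
    rw [ENNReal.ofReal_add (by positivity)
      (add_nonneg (hpos _) (mul_nonneg (Nat.cast_nonneg _) (hpos _))),
      ENNReal.ofReal_add (hpos _) (mul_nonneg (Nat.cast_nonneg _) (hpos _)),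
      ENNReal.ofReal_mul (Nat.cast_nonneg _), ENNReal.ofReal_natCast, ENNReal.ofReal_natCast]
    gcongr
    · exact hpre.trans (habs _)
    · calc _ ≤ ∑ i ∈ Finset.range (numSamples n), _ :=
            Finset.sum_le_sum fun i _ => (hsample i).trans (habs _)
        _ = _ := by rw [Finset.sum_const, Finset.card_range, nsmul_eq_mul]
  set t := ⌊(6 * C' + 1) * Y⌋₊ with ht
  have hY1 : 1 ≤ Y := Real.one_le_rpow (by simp) (by linarith)
  have ht6 : 6 * (C' * Y) ≤ t := by
    have := Nat.lt_floor_add_one ((6 * C' + 1) * Y)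
    rw [← ht] at this
    linarith
  have ht0 : (0 : ℝ) < t := lt_of_lt_of_le (by positivity) ht6
  have hmain := halts_with_property (samplingReduction.applyTo S) (bmmInput w A B)
    (HoldsProduct A B) t le_rfl hE (by exact_mod_cast ht0.ne')
  have hsucc := success_probability hN hK huni
  have hdiv : ENNReal.ofReal (C' * Y) / t ≤ ENNReal.ofReal (1 / 6) := by
    rw [← ENNReal.ofReal_natCast, ← ENNReal.ofReal_div_of_pos ht0]
    refine ENNReal.ofReal_le_ofReal ?_
    rw [div_le_iff₀ ht0]
    linarith
  have h23 : (2 / 3 : ℝ≥0∞) = ENNReal.ofReal (2 / 3) := by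
    rw [ENNReal.ofReal_div_of_pos (by norm_num)]
    norm_num
  rw [h23, ← ENNReal.add_le_add_iff_right (ENNReal.ofReal_ne_top (r := 1 / 3))]
  -- The failures add up to `1/6 + 1/16 ≤ 1/3`: missed deadline and incomplete sampling.
  calc ENNReal.ofReal (2 / 3) + ENNReal.ofReal (1 / 3) = 1 := by
        rw [← ENNReal.ofReal_add (by norm_num) (by norm_num)]
        norm_num
    _ ≤ _ := hsucc
    _ ≤ _ := add_le_add (hmain.trans (add_le_add le_rfl hdiv)) le_rfl
    _ ≤ _ := by
        rw [add_assoc, ← ENNReal.ofReal_add (by norm_num) (by norm_num)]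
        exact add_le_add le_rfl (ENNReal.ofReal_le_ofReal (by norm_num))

end MatrixSampling

theorem mainTheorem4 :
    ∃ T : MatrixSampling.Reduction,
      MatrixSampling.Reduction.QuasilinearOverhead T ∧
      ∀ (combSamplers : Set MatrixSampling.Sampler) (combMultipliers : Set MatrixSampling.Prog),
        (∀ A ∈ combSamplers, MatrixSampling.Reduction.applyTo T A ∈ combMultipliers) →
        MatrixSampling.BMMHard combMultipliers →
        ∀ γ : ℝ, 0 < γ → ¬ ∃ A ∈ combSamplers, A.SamplesInTime γ := by
  refine ⟨MatrixSampling.samplingReduction,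
    MatrixSampling.quasilinearOverhead_samplingReduction, ?_⟩
  rintro combSamplers combMultipliers hT hhard γ hγ ⟨A, hA, hfast⟩
  obtain ⟨ε, hε, h⟩ := MatrixSampling.multipliesInTime_of_samplesInTime hγ hfast
  exact hhard _ (hT A hA) ε hε h
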